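/- \textbf{Conventions.} Let $X$ be a finite set of features. An \emph{entity} is a function $\mathbf e:X\to\{0,1\}$. A \emph{Boolean circuit} $C$ over $X$ is a finite directed acyclic graph in which the nodes (gates) without incoming edges are labelled by a variable of $X$ or a constant $0$ or $1$, the nodes with incoming edges are labelled $\land$, $\lor$ or $\lnot$ (fan-in is unbounded for $\land$ and $\lor$, and exactly $1$ for $\lnot$), and exactly one node, the output gate, has no outgoing edge; $C(\mathbf e)\in\{0,1\}$ is the value of the output gate on $\mathbf e$. For a gate $g$ let $C_g$ be the subcircuit consisting of the gates from which there is a path to $g$, and $\mathrm{var}(g)$ the set of variables that label a gate of $C_g$. The circuit is \emph{deterministic} if for every $\lor$-gate and any two distinct input gates $g_1,g_2$ of it, no entity is accepted by both $C_{g_1}$ and $C_{g_2}$, and \emph{decomposable} if for every $\land$-gate and any two distinct input gates $g_1,g_2$ of it, $\mathrm{var}(g_1)\cap\mathrm{var}(g_2)=\emptyset$. For $\mathrm p:X\to[0,1]$ let $\Pi_{\mathrm p}$ be the product distribution on entities, $\Pi_{\mathrm p}(\mathbf e)=\prod_{\mathbf e(y)=1}\mathrm p(y)\prod_{\mathbf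 e(y)=0}(1-\mathrm p(y))$. For $S\subseteq X$ let $\mathsf{cw}(\mathbf e,S)$ be the set of entities that agree with $\mathbf e$ on $S$, and $$\phi(C,\mathbf e,S)=\mathbb E_{\mathbf e'\sim\Pi_{\mathrm p}}\big[C(\mathbf e')\mid \mathbf e'\in\mathsf{cw}(\mathbf e,S)\big],$$ where, if $\Pi_{\mathrm p}(\mathsf{cw}(\mathbf e,S))=0$, the conditional law is understood to be the product distribution obtained from $\Pi_{\mathrm p}$ by fixing the features in $S$ to their values in $\mathbf e$. The SHAP-score of $x\in X$ under $\Pi_{\mathrm p}$ is $$\mathsf{SHAP}(C,\mathbf e,x)=\sum_{S\subseteq X\setminus\{x\}}\frac{|S|!\,(|X|-|S|-1)!}{|X|!}\Big(\phi(C,\mathbf e,S\cup\{x\})-\phi(C,\mathbf e,S)\Big).$$ \textbf{Theorem.} The following problem can be solved in polynomial time (on a random-access machine under the logarithmic cost criterion, in the total binary length of the input). Given as input a deterministic and decomposable Boolean circuit $C$ over a finite set of features $X$, rational probability values $\mathrm p(y)\in[0,1]$ for all $y\in X$, an entity $\mathbf e:X\to\{0,1\}$ and a feature $x\in X$, compute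 the rational number $\mathsf{SHAP}(C,\mathbf e,x)$ under the distribution $\Pi_{\mathrm p}$ (as a fraction in lowest terms). -/

import Mathlib

/-! ## Boolean circuits -/

/-- Labels of the gates of a Boolean circuit over the set of variables `X`. -/
inductive GateLabel (X : Type*) where
  | var (x : X)
  | const (b : Bool)
  | and
  | or
  | not

/-- Variable gates and constant gates. -/
def GateLabel.IsInput {X : Type*} : GateLabel X → Prop
  | .var _ => True
  | .const _ => True
  | _ => False

/-- A Boolean circuit over the variables `X`, with set of gates `G`: a directed acyclic graph
(`wire g' g = true` means that there is an edge from `g'` to `g`, i.e. `g'` is an input gate of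
`g`) with labelled nodes.  The fan-in of `and`- and `or`-gates is unbounded, and the gates are
not assumed to be listed in any particular order. -/
structure BooleanCircuit (X G : Type*) where
  label : G → GateLabel X
  wire : G → G → Bool
  acyclic : ∀ g, ¬ Relation.TransGen (fun a b => wire a b = true) g g
  /-- nodes without incoming edges are variable or constant gates -/
  source_isInput : ∀ g, (∀ g', wire g' g = false) → (label g).IsInput
  /-- nodes with incoming edges are logic gates -/
  logic_of_wire : ∀ g g', wire g' g = true → ¬ (label g).IsInput
  /-- a negation gate has exactly one incoming edge -/
  fanin_not : ∀ g, label g = .not → ∃! g', wire g' g = true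
  /-- exactly one node has no outgoing edge -/
  unique_output : ∃! g, ∀ g', wire g g' = false

namespace BooleanCircuit

variable {X G : Type*}

theorem wellFounded_wire [Finite G] (C : BooleanCircuit X G) :
    WellFounded (fun a b => C.wire a b = true) := by
  have h : WellFounded (Relation.TransGen (fun a b => C.wire a b = true)) := by
    have : Std.Irrefl (Relation.TransGen (fun a b => C.wire a b = true)) := ⟨C.acyclic⟩
    have : IsTrans G (Relation.TransGen (fun a b => C.wire a b = true)) :=
      ⟨fun _ _ _ => Relation.TransGen.trans⟩
    exact Finite.wellFounded_of_trans_of_irrefl _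
  exact h.mono fun _ _ hab => Relation.TransGen.single hab

open Classical in
/-- The value of gate `g` when the circuit is evaluated over the entity `e`. -/
noncomputable def eval [Finite G] (C : BooleanCircuit X G) (e : X → Bool) : G → Bool :=
  C.wellFounded_wire.fix fun g val =>
    match C.label g with
    | .var x => e x
    | .const b => b
    | .and => decide (∀ g' (h : C.wire g' g = true), val g' h = true)
    | .or => decide (∃ g', ∃ h : C.wire g' g = true, val g' h = true)
    | .not => decide (∀ g' (h : C.wire g' g = true), val g' h = false)

open Classical in
theorem eval_eq [Finite G] (C : BooleanCircuit X G) (e : X → Bool) (g : G) :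
    C.eval e g =
      match C.label g with
      | .var x => e x
      | .const b => b
      | .and => decide (∀ g', C.wire g' g = true → C.eval e g' = true)
      | .or => decide (∃ g', C.wire g' g = true ∧ C.eval e g' = true)
      | .not => decide (∀ g', C.wire g' g = true → C.eval e g' = false) := by
  rw [eval, WellFounded.fix_eq]
  cases C.label g <;> simp

/-- The output gate: the unique node without outgoing edges. -/
noncomputable def output (C : BooleanCircuit X G) : G := C.unique_output.choose

/-- The Boolean classifier represented by the circuit. -/
noncomputable def classifier [Finite G] (C : BooleanCircuit X G) (e : X → Bool) : Bool :=
  C.eval e C.output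

/-- `var(g)`: the variables labelling a variable gate from which there is a path to `g`. -/
def vars (C : BooleanCircuit X G) (g : G) : Set X :=
  {x | ∃ g', Relation.ReflTransGen (fun a b => C.wire a b = true) g' g ∧ C.label g' = .var x}

/-- Every `or`-gate is deterministic: no entity is accepted by two distinct input gates of it.
(The value of the subcircuit rooted at a gate is the value of that gate.) -/
def Deterministic [Finite G] (C : BooleanCircuit X G) : Prop :=
  ∀ g, C.label g = .or → ∀ g₁ g₂, C.wire g₁ g = true → C.wire g₂ g = true → g₁ ≠ g₂ →
    ¬ ∃ e : X → Bool, C.eval e g₁ = true ∧ C.eval e g₂ = true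

/-- Every `and`-gate is decomposable: two distinct input gates of it share no variable. -/
def Decomposable (C : BooleanCircuit X G) : Prop :=
  ∀ g, C.label g = .and → ∀ g₁ g₂, C.wire g₁ g = true → C.wire g₂ g = true → g₁ ≠ g₂ →
    C.vars g₁ ∩ C.vars g₂ = ∅

end BooleanCircuit

/-! ## The SHAP-score under a product distribution -/

section Shap

variable {X : Type*} [Fintype X] [DecidableEq X]

/-- The product distribution on entities in which each feature `y` independently takes the
value `1` with probability `p y`. -/
def productDistribution (p : X → ℚ) (e : X → Bool) : ℚ :=
  (∏ y with e y = true, p y) * (∏ y with e y = false, (1 - p y))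

/-- `cw(e, S)`: the entities that coincide with `e` on `S`. -/
def consistentWith (e : X → Bool) (S : Finset X) : Finset (X → Bool) :=
  {e' | ∀ y ∈ S, e' y = e y}

/-- The marginals `p`, with those of the features in `S` replaced by the values of `e`. -/
def fixMarginals (p : X → ℚ) (e : X → Bool) (S : Finset X) (y : X) : ℚ :=
  if y ∈ S then (if e y = true then 1 else 0) else p y

/-- `φ(M, e, S)`: the conditional expectation of `M e'` given `e' ∈ cw(e, S)`, for `e'` drawn
from the product distribution generated by `p`.  If the event `cw(e, S)` is null (possible only
when some `p y` with `y ∈ S` is `0` or `1`), the conditional law is taken, as usual for independent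
features, to fix the features in `S` to `e` and to leave the law of the others unchanged. -/
def condExpectation (p : X → ℚ) (M : (X → Bool) → Bool) (e : X → Bool) (S : Finset X) : ℚ :=
  if ∑ e' ∈ consistentWith e S, productDistribution p e' ≠ 0 then
    (∑ e' ∈ consistentWith e S, productDistribution p e' * (if M e' = true then 1 else 0)) /
      ∑ e' ∈ consistentWith e S, productDistribution p e'
  else
    ∑ e', productDistribution (fixMarginals p e S) e' * (if M e' = true then 1 else 0)

/-- The SHAP-score of the feature `x` on the entity `e` with respect to the classifier `M`,
under the product distribution generated by `p`. -/
def shapScore (p : X → ℚ) (M : (X → Bool) → Bool) (e : X → Bool) (x : X) : ℚ :=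
  ∑ S ∈ (Finset.univ.erase x).powerset,
    ((Nat.factorial S.card : ℚ) * (Nat.factorial (Fintype.card X - S.card - 1) : ℚ)
        / (Nat.factorial (Fintype.card X) : ℚ))
      * (condExpectation p M e (insert x S) - condExpectation p M e S)

end Shap

/-! ## Random-access machines with logarithmic cost, and polynomial time

The memory consists of arrays named by natural numbers, each cell `(k, i)` of which holds a natural
number; a program mentions finitely many arrays, and may address their cells indirectly.  As usual
for the logarithmic cost criterion, every operation is charged the number of binary digits of all
of its operands (addresses included). -/

/-- A memory: `σ k i` is the content of cell `i` of array `k`. -/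
abbrev RamMemory := ℕ → ℕ → ℕ

/-- Arithmetic expressions of random-access machine programs. -/
inductive RamExpr where
  | lit (c : ℕ)
  | read (k : ℕ) (i : RamExpr)
  | add (a b : RamExpr)
  | sub (a b : RamExpr)
  | mul (a b : RamExpr)
  | div (a b : RamExpr)

namespace RamExpr

/-- Value of an expression; subtraction is truncated at zero and division is the integer
quotient (zero for the divisor zero). -/
def value (σ : RamMemory) : RamExpr → ℕ
  | lit c => c
  | read k i => σ k (i.value σ)
  | add a b => a.value σ + b.value σ
  | sub a b => a.value σ - b.value σ
  | mul a b => a.value σ * b.value σ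
  | div a b => a.value σ / b.value σ

/-- Logarithmic cost of evaluating an expression (`Nat.size` is the length in binary). -/
def cost (σ : RamMemory) : RamExpr → ℕ
  | lit c => Nat.size c + 1
  | read k i => i.cost σ + Nat.size (i.value σ) + Nat.size (σ k (i.value σ)) + 1
  | add a b => a.cost σ + b.cost σ + Nat.size (a.value σ) + Nat.size (b.value σ) + 1
  | sub a b => a.cost σ + b.cost σ + Nat.size (a.value σ) + Nat.size (b.value σ) + 1
  | mul a b => a.cost σ + b.cost σ + Nat.size (a.value σ) + Nat.size (b.value σ) + 1
  | div a b => a.cost σ + b.cost σ + Nat.size (a.value σ) + Nat.size (b.value σ) + 1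

end RamExpr

/-- Random-access machine programs. -/
inductive RamProg where
  | skip
  /-- store the value of `a` in the cell of array `k` whose address is the value of `i` -/
  | write (k : ℕ) (i a : RamExpr)
  | seq (c d : RamProg)
  /-- run `c` if the value of `a` is nonzero, and `d` otherwise -/
  | branch (a : RamExpr) (c d : RamProg)
  /-- run `c` as long as the value of `a` is nonzero -/
  | loop (a : RamExpr) (c : RamProg)

/-- `RamExec c σ τ t`: started in memory `σ`, the program `c` halts in memory `τ`, at
logarithmic cost `t`. -/
inductive RamExec : RamProg → RamMemory → RamMemory → ℕ → Prop where
  | skip (σ : RamMemory) : RamExec .skip σ σ 1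
  | write (k : ℕ) (i a : RamExpr) (σ : RamMemory) :
      RamExec (.write k i a) σ
        (Function.update σ k (Function.update (σ k) (i.value σ) (a.value σ)))
        (i.cost σ + a.cost σ + Nat.size (i.value σ) + Nat.size (a.value σ) + 1)
  | seq {c d : RamProg} {σ τ υ : RamMemory} {s t : ℕ} :
      RamExec c σ τ s → RamExec d τ υ t → RamExec (.seq c d) σ υ (s + t)
  | branch_true {a : RamExpr} {c d : RamProg} {σ τ : RamMemory} {t : ℕ} :
      a.value σ ≠ 0 → RamExec c σ τ t → RamExec (.branch a c d) σ τ (a.cost σ + 1 + t)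
  | branch_false {a : RamExpr} {c d : RamProg} {σ τ : RamMemory} {t : ℕ} :
      a.value σ = 0 → RamExec d σ τ t → RamExec (.branch a c d) σ τ (a.cost σ + 1 + t)
  | loop_done {a : RamExpr} {c : RamProg} {σ : RamMemory} :
      a.value σ = 0 → RamExec (.loop a c) σ σ (a.cost σ + 1)
  | loop_step {a : RamExpr} {c : RamProg} {σ τ υ : RamMemory} {s t : ℕ} :
      a.value σ ≠ 0 → RamExec c σ τ s → RamExec (.loop a c) τ υ t →
        RamExec (.loop a c) σ υ (a.cost σ + 1 + s + t)

/-- The initial memory on input `l`: array `0` holds the length of `l` followed by the entries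
of `l`, and all other cells hold `0`. -/
def ramInput (l : List ℕ) : RamMemory :=
  fun k i => if k = 0 then (l.length :: l).getD i 0 else 0

/-- The memory `σ` presents the output `l`: array `1` starts with the length of `l` followed by
the entries of `l`. -/
def RamOutput (σ : RamMemory) (l : List ℕ) : Prop :=
  ∀ i ≤ l.length, σ 1 i = (l.length :: l).getD i 0

/-- The length of an input: the total number of binary digits (plus one separator per entry). -/
def inputLength (l : List ℕ) : ℕ := (l.map fun a => Nat.size a + 1).sum

/-- Given encodings of inputs and outputs by lists of natural numbers, the problem
"given an instance `a ∈ D`, compute `f a`" can be solved in polynomial time. -/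
def PolyTimeComputableOn {α β : Type*} (encIn : α → List ℕ) (encOut : β → List ℕ)
    (D : Set α) (f : α → β) : Prop :=
  ∃ (prog : RamProg) (P : Polynomial ℕ), ∀ a ∈ D, ∃ (τ : RamMemory) (t : ℕ),
    RamExec prog (ramInput (encIn a)) τ t ∧ t ≤ P.eval (inputLength (encIn a)) ∧
      RamOutput τ (encOut (f a))

/-! ## Inputs and outputs of the problem -/

/-- A rational number, by its sign and its numerator and denominator in lowest terms. -/
def encodeRat (q : ℚ) : List ℕ := [if q < 0 then 1 else 0, q.num.natAbs, q.den]

/-- Input data: a circuit (with features `0, …, n - 1` and gates `0, …, m - 1`), rational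
marginals, an entity, and a feature. -/
structure ShapInput where
  n : ℕ
  m : ℕ
  C : BooleanCircuit (Fin n) (Fin m)
  p : Fin n → ℚ
  e : Fin n → Bool
  x : Fin n

def GateLabel.encode {n : ℕ} : GateLabel (Fin n) → List ℕ
  | .var x => [0, x]
  | .const b => [1, b.toNat]
  | .and => [2, 0]
  | .or => [3, 0]
  | .not => [4, 0]

/-- The number of features, the number of gates, the gate labels, the adjacency matrix (row by
row), the marginals, the entity, and the feature. -/
def ShapInput.encode (I : ShapInput) : List ℕ :=
  [I.n, I.m]
    ++ (List.finRange I.m).flatMap (fun g => (I.C.label g).encode)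
    ++ (List.finRange I.m).flatMap
        (fun g => (List.finRange I.m).map fun g' => (I.C.wire g g').toNat)
    ++ (List.finRange I.n).flatMap (fun y => encodeRat (I.p y))
    ++ (List.finRange I.n).map (fun y => (I.e y).toNat)
    ++ [(I.x : ℕ)]

/-- The legal instances: the circuit is deterministic and decomposable, and every marginal is a
probability. -/
def shapInstances : Set ShapInput :=
  {I | I.C.Deterministic ∧ I.C.Decomposable ∧ ∀ y, 0 ≤ I.p y ∧ I.p y ≤ 1}

/-- The requested value. -/
noncomputable def ShapInput.score (I : ShapInput) : ℚ :=
  shapScore I.p I.C.classifier I.e I.x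

/-! The score is read off from a single weighted model count. Clearing denominators turns the
marginals into integer weights for the two values of each feature. With the features in `S` fixed to
`e`, the conditional expectation is then an integer count divided by the common denominator `D` of
the marginals, whether or not the conditioning event is null (`condExpectation_eq`). Grouped by
`|S|`, the score is a combination, with factorial coefficients, of `2 n` integers: for each size
`k`, the sums of counts over the `S` of size `k`, with and without `x` fixed as well
(`shapScore_eq_div`).

To get all of them at once, add to the marginal weight of each value the weight that fixes the
feature to `e`, multiplied by a marker `z y`. Expanding the product over the features yields the sum
over all `S` of `∏ y ∈ S, z y` times the count with `S` fixed (`weightedCount_mixedWeight`). Each of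
the `2 n` integers is below `B = 2 ^ n * D`, so with marker `B` for the ordinary features and `B ^
n` for `x` they are the base-`B` digits of one number (`weightedCount_mixedWeight_eq_digits`).

That number is computed gate by gate. Let `T` be the total weight of all entities. Determinism makes
the counts at an `or`-gate add up, negation subtracts from `T`, and decomposability makes the inputs
of an `and`-gate independent, so counts multiply after division by `T` (`weightedCount_and`). As the
gates come in no particular order, all counts are recomputed as often as there are gates
(`runs_evalGates`). Digit extraction and Euclid's algorithm finish the computation.

For the running time it suffices that stored numbers stay below `2 ^ L` and loops make at most `L`
iterations, where `L` is polynomial in the input length: the program is fixed, so its cost is then a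
fixed polynomial in `L` (`Runs`, `ShapInput.fits`). -/

/-! ## Weighted model counting -/

section WeightedCount

variable {X : Type*} [Fintype X] [DecidableEq X]

/-- The total weight of the entities accepted by `f`, where an entity has the product of the
weights of its values. -/
def weightedCount (w : X → Bool → ℕ) (f : (X → Bool) → Bool) : ℕ :=
  ∑ u : X → Bool, if f u = true then ∏ y, w y (u y) else 0

/-- The total weight of all entities. -/
def totalWeight (w : X → Bool → ℕ) : ℕ := ∏ y, (w y true + w y false)

theorem sum_prod_bool {R : Type*} [CommSemiring R] (w : X → Bool → R) :
    ∑ u : X → Bool, ∏ y, w y (u y) = ∏ y, (w y true + w y false) := by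
  have h := (Finset.prod_univ_sum (fun _ : X => (Finset.univ : Finset Bool)) w).symm
  rw [Fintype.piFinset_univ] at h
  rw [h]
  simp

theorem weightedCount_true (w : X → Bool → ℕ) :
    weightedCount w (fun _ => true) = totalWeight w := by
  simp [weightedCount, totalWeight, sum_prod_bool]

theorem weightedCount_false (w : X → Bool → ℕ) : weightedCount w (fun _ => false) = 0 := by
  simp [weightedCount]

theorem weightedCount_or (w : X → Bool → ℕ) (f g : (X → Bool) → Bool)
    (h : ∀ u, ¬ (f u = true ∧ g u = true)) :
    weightedCount w (fun u => f u || g u) = weightedCount w f + weightedCount w g := by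
  rw [weightedCount, weightedCount, weightedCount, ← Finset.sum_add_distrib]
  refine Finset.sum_congr rfl fun u _ => ?_
  have := h u
  cases hf : f u <;> cases hg : g u <;> simp_all

theorem weightedCount_not (w : X → Bool → ℕ) (f : (X → Bool) → Bool) :
    weightedCount w (fun u => !f u) + weightedCount w f = totalWeight w := by
  rw [← weightedCount_or, ← weightedCount_true]
  · congr 1; funext u; simp
  · intro u; cases f u <;> simp

theorem weightedCount_le (w : X → Bool → ℕ) (f : (X → Bool) → Bool) :
    weightedCount w f ≤ totalWeight w := by
  rw [← weightedCount_not w f]; exact Nat.le_add_left _ _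

/-- Setting the weight of the value `false` at `x` to zero discards exactly the entities with `u x =
false`, so the count is again a product over the features. It differs from the total weight only in
the factor at `x`; cross-multiplying avoids a division. -/
theorem weightedCount_apply (w : X → Bool → ℕ) (x : X) :
    weightedCount w (fun u => u x) * (w x true + w x false) = totalWeight w * w x true := by
  have h : weightedCount w (fun u => u x) =
      -- The trivial conditional is what the modified weight becomes at the value `true`; it is kept
      -- so that the product formula applies literally.
      ∏ y, ((if y = x then 1 else 1) * w y true + (if y = x then 0 else 1) * w y false) := by
    have h := sum_prod_bool fun y b => (if y = x then (if b = true then 1 else 0) else 1) * w y b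
    simp only [if_true, Bool.false_eq_true, if_false] at h
    rw [← h, weightedCount]
    refine Finset.sum_congr rfl fun u _ => ?_
    rw [Finset.prod_mul_distrib, Finset.prod_ite_eq' Finset.univ x]
    simp
  rw [h, totalWeight, ← Finset.mul_prod_erase _ _ (Finset.mem_univ x),
    ← Finset.mul_prod_erase _ (fun y => w y true + w y false) (Finset.mem_univ x)]
  have : ∏ y ∈ Finset.univ.erase x,
      ((if y = x then 1 else 1) * w y true + (if y = x then 0 else 1) * w y false) =
      ∏ y ∈ Finset.univ.erase x, (w y true + w y false) := by
    refine Finset.prod_congr rfl fun y hy => ?_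
    simp [Finset.ne_of_mem_erase hy]
  rw [this]
  simp
  ring

/-- The Boolean function `f` depends only on the variables in `A`. -/
def DependsOnlyOn {X : Type*} (f : (X → Bool) → Bool) (A : Set X) : Prop :=
  ∀ u v, (∀ y ∈ A, u y = v y) → f u = f v

open Classical in
-- Independence, without division: on pairs `(u, v)` of entities, exchange the coordinates outside
-- `A`. This involution preserves the product of the two weights. It leaves `f` of the first
-- component unchanged and makes `g` of the second component equal to `g u`, because `B` lies
-- outside `A`.
theorem weightedCount_and (w : X → Bool → ℕ) (f g : (X → Bool) → Bool) (A B : Set X)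
    (hf : DependsOnlyOn f A) (hg : DependsOnlyOn g B) (hAB : Disjoint A B) :
    weightedCount w (fun u => f u && g u) * totalWeight w =
      weightedCount w f * weightedCount w g := by
  rw [← weightedCount_true]
  unfold weightedCount
  rw [Finset.sum_mul_sum, Finset.sum_mul_sum, ← Finset.sum_product', ← Finset.sum_product']
  let s : (X → Bool) × (X → Bool) → (X → Bool) × (X → Bool) := fun q =>
    (fun y => if y ∈ A then q.1 y else q.2 y, fun y => if y ∈ A then q.2 y else q.1 y)
  have hs : ∀ q, s (s q) = q := by
    intro q
    ext y <;> by_cases hy : y ∈ A <;> simp [s, hy]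
  refine Finset.sum_nbij' s s (by simp) (by simp) (fun q _ => hs q) (fun q _ => hs q) ?_
  rintro ⟨u, v⟩ -
  have h1 : f (s (u, v)).1 = f u := hf _ _ fun y hy => by simp [s, hy]
  have h2 : g (s (u, v)).2 = g u := hg _ _ fun y hy => by
    simp [s, Set.disjoint_right.1 hAB hy]
  have h3 : (∏ y, w y ((s (u, v)).1 y)) * ∏ y, w y ((s (u, v)).2 y) =
      (∏ y, w y (u y)) * ∏ y, w y (v y) := by
    rw [← Finset.prod_mul_distrib, ← Finset.prod_mul_distrib]
    refine Finset.prod_congr rfl fun y _ => ?_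
    by_cases hy : y ∈ A <;> simp [s, hy, mul_comm]
  rw [h1, h2]
  cases hu : f u <;> cases hv : g u <;> simp [hu, hv, h3]

end WeightedCount

/-! ### Counts at the gates of a circuit -/

namespace BooleanCircuit

variable {X G : Type*}

theorem vars_subset_of_wire (C : BooleanCircuit X G) {g' g : G} (h : C.wire g' g = true) :
    C.vars g' ⊆ C.vars g := fun _ ⟨a, ha, hx⟩ => ⟨a, ha.tail h, hx⟩

theorem dependsOnlyOn_eval [Finite G] (C : BooleanCircuit X G) (g : G) :
    DependsOnlyOn (fun u => C.eval u g) (C.vars g) := by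
  induction g using C.wellFounded_wire.induction with
  | _ g ih =>
  intro u v huv
  have ih' : ∀ g', C.wire g' g = true → C.eval u g' = C.eval v g' := fun g' h =>
    ih g' h u v fun y hy => huv y (C.vars_subset_of_wire h hy)
  have hwire : ∀ P : Bool → Prop,
      (∀ g', C.wire g' g = true → P (C.eval u g')) ↔
        ∀ g', C.wire g' g = true → P (C.eval v g') := fun P =>
    forall_congr' fun g' => imp_congr_right fun h => by rw [ih' g' h]
  have hwire' : (∃ g', C.wire g' g = true ∧ C.eval u g' = true) ↔
      ∃ g', C.wire g' g = true ∧ C.eval v g' = true :=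
    exists_congr fun g' => and_congr_right fun h => by rw [ih' g' h]
  simp only
  rw [eval_eq, eval_eq C v]
  cases hl : C.label g with
  | var x => exact huv x ⟨g, .refl, hl⟩
  | const b => rfl
  | and => simpa using hwire (· = true)
  | or => simpa using hwire'
  | not => simpa using hwire (· = false)

/-- Conjunction of the gates in `s`. -/
noncomputable def conj [Finite G] (C : BooleanCircuit X G) (s : Finset G) (u : X → Bool) : Bool :=
  by classical exact decide (∀ g ∈ s, C.eval u g = true)

/-- Disjunction of the gates in `s`. -/
noncomputable def disj [Finite G] (C : BooleanCircuit X G) (s : Finset G) (u : X → Bool) : Bool :=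
  by classical exact decide (∃ g ∈ s, C.eval u g = true)

variable [Fintype X] [DecidableEq X] [Finite G] (C : BooleanCircuit X G)
  (w : X → Bool → ℕ)

theorem weightedCount_conj_empty : weightedCount w (C.conj ∅) = totalWeight w := by
  simp [← weightedCount_true, weightedCount, conj]

theorem weightedCount_disj_empty : weightedCount w (C.disj ∅) = 0 := by
  simp [weightedCount, disj]

variable [DecidableEq G] in
-- The factor `totalWeight w` appears because every count ranges over entities on all of `X`, not
-- only over the variables below the gate. With it, the inputs of an `and`-gate can be absorbed one
-- at a time.
theorem weightedCount_conj_insert {s : Finset G} {g : G}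
    (h : ∀ g' ∈ s, C.vars g' ∩ C.vars g = ∅) :
    weightedCount w (C.conj s) * weightedCount w (fun u => C.eval u g) =
      weightedCount w (C.conj (insert g s)) * totalWeight w := by
  have hs : DependsOnlyOn (C.conj s) (⋃ g' ∈ s, C.vars g') := by
    intro u v huv
    have : ∀ g' ∈ s, C.eval u g' = C.eval v g' := fun g' hg' =>
      C.dependsOnlyOn_eval g' u v fun y hy => huv y (Set.mem_biUnion hg' hy)
    simp only [conj, decide_eq_decide]
    exact forall_congr' fun g' => imp_congr_right fun hg' => by rw [this g' hg']
  rw [← weightedCount_and w _ _ _ _ hs (C.dependsOnlyOn_eval g)]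
  · congr 2; funext u; simp [conj, Bool.and_comm]
  · simp only [Set.disjoint_iUnion_left]
    exact fun g' hg' => Set.disjoint_iff_inter_eq_empty.2 (h g' hg')

variable [DecidableEq G] in
theorem weightedCount_disj_insert {s : Finset G} {g : G}
    (h : ∀ g' ∈ s, ¬ ∃ u : X → Bool, C.eval u g' = true ∧ C.eval u g = true) :
    weightedCount w (C.disj (insert g s)) =
      weightedCount w (C.disj s) + weightedCount w (fun u => C.eval u g) := by
  rw [← weightedCount_or]
  · congr 1; funext u; simp [disj, Bool.or_comm]
  · rintro u ⟨h1, h2⟩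
    obtain ⟨g', hg', h3⟩ : ∃ g' ∈ s, C.eval u g' = true := by simpa [disj] using h1
    exact h g' hg' ⟨u, h3, h2⟩

end BooleanCircuit

/-! ## The SHAP-score by weighted model counting -/

section ShapCount

variable {X : Type*} [Fintype X] [DecidableEq X]

/-- Integral weights, proportional to the marginals, of the two values of the feature `y`. -/
def marginalWeight (p : X → ℚ) (y : X) (b : Bool) : ℕ :=
  if b = true then (p y).num.natAbs else (p y).den - (p y).num.natAbs

/-- The weight `(p y).den` for the value of `e`, and `0` for the other one. -/
def entityWeight (p : X → ℚ) (e : X → Bool) (y : X) (b : Bool) : ℕ :=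
  if e y = b then (p y).den else 0

/-- The weights of the product distribution in which the features in `S` are fixed to `e`. -/
def fixedWeight (p : X → ℚ) (e : X → Bool) (S : Finset X) (y : X) (b : Bool) : ℕ :=
  if y ∈ S then entityWeight p e y b else marginalWeight p y b

/-- A weight that keeps track, by powers of `z y`, of the features fixed to `e`. -/
def mixedWeight (p : X → ℚ) (e : X → Bool) (z : X → ℕ) (y : X) (b : Bool) : ℕ :=
  entityWeight p e y b * z y + marginalWeight p y b

/-- The common denominator of the marginals. -/
def commonDen (p : X → ℚ) : ℕ := ∏ y, (p y).den

/-- For each entity the weight is a product of binomials. Expanding it means choosing the set `S` of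
features that contribute their marked summand. -/
theorem weightedCount_mixedWeight (p : X → ℚ) (e : X → Bool) (z : X → ℕ)
    (M : (X → Bool) → Bool) :
    weightedCount (mixedWeight p e z) M =
      ∑ S ∈ (Finset.univ : Finset X).powerset,
        (∏ y ∈ S, z y) * weightedCount (fixedWeight p e S) M := by
  simp only [weightedCount, Finset.mul_sum]
  rw [Finset.sum_comm]
  refine Finset.sum_congr rfl fun u _ => ?_
  cases M u
  · simp
  simp only [if_true, mixedWeight]
  rw [Finset.prod_add]
  refine Finset.sum_congr rfl fun S hS => ?_
  rw [Finset.prod_mul_distrib, mul_comm (∏ i ∈ S, entityWeight p e i (u i)), mul_assoc]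
  congr 1
  rw [← Finset.prod_mul_prod_compl S]
  congr 1
  · exact Finset.prod_congr rfl fun y hy => by simp [fixedWeight, hy]
  · rw [Finset.compl_eq_univ_sdiff]
    exact Finset.prod_congr rfl fun y hy => by
      simp [fixedWeight, (Finset.mem_sdiff.1 hy).2]

variable {p : X → ℚ} (hp : ∀ y, 0 ≤ p y ∧ p y ≤ 1) (e : X → Bool)

omit [Fintype X] [DecidableEq X] in
include hp in
theorem num_natAbs_le_den (y : X) : (p y).num.natAbs ≤ (p y).den := by
  have h0 : 0 ≤ (p y).num := Rat.num_nonneg.2 (hp y).1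
  have h1 : (p y).num ≤ (p y).den := by simpa using Rat.num_le_denom_iff.2 (hp y).2
  omega

omit [Fintype X] [DecidableEq X] in
include hp in
theorem cast_marginalWeight (y : X) (b : Bool) :
    (marginalWeight p y b : ℚ) = (p y).den * (if b = true then p y else 1 - p y) := by
  have h0 : (((p y).num.natAbs : ℕ) : ℚ) = (p y).num := by
    rw [← Int.cast_natCast, Int.natAbs_of_nonneg (Rat.num_nonneg.2 (hp y).1)]
  have h1 : ((p y).den : ℚ) * p y = (p y).num := by rw [mul_comm, Rat.mul_den_eq_num]
  cases b
  · simp [marginalWeight, Nat.cast_sub (num_natAbs_le_den hp y), mul_sub, h1, h0]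
  · simp [marginalWeight, h1, h0]

omit [Fintype X] in
include hp in
theorem cast_fixedWeight (S : Finset X) (y : X) (b : Bool) :
    (fixedWeight p e S y b : ℚ) = (p y).den *
      (if b = true then fixMarginals p e S y else 1 - fixMarginals p e S y) := by
  by_cases hy : y ∈ S
  · cases b <;> cases he : e y <;> simp [fixedWeight, entityWeight, fixMarginals, hy, he]
  · simp [fixedWeight, fixMarginals, hy, cast_marginalWeight hp]

omit [DecidableEq X] in
theorem productDistribution_eq_prod (q : X → ℚ) (u : X → Bool) :
    productDistribution q u = ∏ y, if u y = true then q y else 1 - q y := by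
  rw [Finset.prod_ite]
  simp [productDistribution]

include hp in
theorem sum_productDistribution_fixMarginals (S : Finset X) (M : (X → Bool) → Bool) :
    ∑ u, productDistribution (fixMarginals p e S) u * (if M u = true then 1 else 0) =
      weightedCount (fixedWeight p e S) M / commonDen p := by
  have hD : (commonDen p : ℚ) ≠ 0 := by
    simp [commonDen, Finset.prod_eq_zero_iff]
  rw [eq_div_iff hD, Finset.sum_mul, weightedCount, Nat.cast_sum]
  refine Finset.sum_congr rfl fun u _ => ?_
  cases M u
  · simp
  · simp only [if_true, mul_one, Nat.cast_prod, cast_fixedWeight hp, productDistribution_eq_prod,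
      commonDen, Finset.prod_mul_distrib]
    rw [mul_comm]

/-- If `u` agrees with `e` on `S`, its factors on `S` are those of `e` and the fixed distribution
has factors `1` there; otherwise the fixed distribution gives `u` mass zero. No division occurs, so
null events are covered. -/
theorem productDistribution_consistent (p : X → ℚ) (S : Finset X) (u : X → Bool) :
    (if u ∈ consistentWith e S then productDistribution p u else 0) =
      (∏ y ∈ S, if e y = true then p y else 1 - p y) *
        productDistribution (fixMarginals p e S) u := by
  simp only [productDistribution_eq_prod]
  rw [← Finset.prod_mul_prod_compl S fun y => if u y = true then fixMarginals p e S y else _]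
  by_cases h : u ∈ consistentWith e S
  · have h' : ∀ y ∈ S, u y = e y := by simpa [consistentWith] using h
    rw [if_pos h, ← Finset.prod_mul_prod_compl S]
    have h1 : ∏ y ∈ S, (if u y = true then fixMarginals p e S y else 1 - fixMarginals p e S y) =
        1 := Finset.prod_eq_one fun y hy => by
      rw [h' y hy]; cases he : e y <;> simp [fixMarginals, hy, he]
    rw [h1, one_mul]
    congr 1
    · exact Finset.prod_congr rfl fun y hy => by rw [h' y hy]
    · exact Finset.prod_congr rfl fun y hy => by
        simp [fixMarginals, Finset.mem_compl.1 hy]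
  · obtain ⟨y, hy, hne⟩ : ∃ y ∈ S, u y ≠ e y := by simpa [consistentWith] using h
    have h0 : ∏ y ∈ S, (if u y = true then fixMarginals p e S y else 1 - fixMarginals p e S y) =
        0 := Finset.prod_eq_zero hy (by
      cases he : e y <;> cases hu : u y <;> simp_all [fixMarginals])
    rw [if_neg h, h0]
    simp

include hp in
-- The numerator and the mass of the event share the factor contributed by `S`. If it is nonzero it
-- cancels; if it is zero, the convention for null events gives the same expression.
theorem condExpectation_eq (S : Finset X) (M : (X → Bool) → Bool) :
    condExpectation p M e S = weightedCount (fixedWeight p e S) M / commonDen p := by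
  have key : ∀ M : (X → Bool) → Bool,
      ∑ u ∈ consistentWith e S, productDistribution p u * (if M u = true then 1 else 0) =
      (∏ y ∈ S, if e y = true then p y else 1 - p y) *
        ∑ u, productDistribution (fixMarginals p e S) u * (if M u = true then 1 else 0) := by
    intro M
    simp only [Finset.mul_sum, ← mul_assoc, ← productDistribution_consistent]
    simp only [ite_mul, zero_mul]
    rw [← Finset.sum_filter]
    simp
  have h1 : ∑ u ∈ consistentWith e S, productDistribution p u =
      ∏ y ∈ S, if e y = true then p y else 1 - p y := by
    have h := key fun _ => true
    have h2 : ∑ u, productDistribution (fixMarginals p e S) u = 1 := by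
      simp only [productDistribution_eq_prod]
      rw [sum_prod_bool fun y b => if b = true then fixMarginals p e S y else _]
      simp
    simpa [h2] using h
  rw [condExpectation, key, h1, sum_productDistribution_fixMarginals hp]
  split_ifs with h
  · rw [mul_div_cancel_left₀ _ h]
  · rfl

/-- The sum of the counts with the features in `S` fixed to `e`, over the `S` of size `k`
without `x`. -/
def countWithout (p : X → ℚ) (e : X → Bool) (x : X) (M : (X → Bool) → Bool) (k : ℕ) : ℕ :=
  ∑ S ∈ (Finset.univ.erase x).powersetCard k, weightedCount (fixedWeight p e S) M

/-- The sum of the counts with `x` and the features in `S` fixed to `e`, over the `S` of size `k`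
without `x`. -/
def countWith (p : X → ℚ) (e : X → Bool) (x : X) (M : (X → Bool) → Bool) (k : ℕ) : ℕ :=
  ∑ S ∈ (Finset.univ.erase x).powersetCard k, weightedCount (fixedWeight p e (insert x S)) M

theorem card_erase_succ (x : X) : (Finset.univ.erase x).card + 1 = Fintype.card X := by
  rw [Finset.card_erase_add_one (Finset.mem_univ x), Finset.card_univ]

include hp in
theorem totalWeight_fixedWeight (S : Finset X) :
    totalWeight (fixedWeight p e S) = commonDen p := by
  refine Finset.prod_congr rfl fun y _ => ?_
  have := num_natAbs_le_den hp y
  by_cases hy : y ∈ S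
  · cases he : e y <;> simp [fixedWeight, entityWeight, hy, he]
  · simp [fixedWeight, marginalWeight, hy]; omega

omit [DecidableEq X] in
theorem commonDen_pos (p : X → ℚ) : 0 < commonDen p := Finset.prod_pos fun y _ => (p y).den_pos

/-- There are at most `2 ^ (n - 1)` sets to sum over, where `n` is the number of features; the
missing factor `2` makes the bound strict, as needed for digits. -/
theorem sum_powersetCard_lt (x : X) (k : ℕ) (f : Finset X → ℕ) {D : ℕ} (hD : 0 < D)
    (hf : ∀ S, f S ≤ D) :
    ∑ S ∈ (Finset.univ.erase x).powersetCard k, f S < 2 ^ Fintype.card X * D := by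
  calc _ ≤ ∑ S ∈ (Finset.univ.erase x).powersetCard k, D := Finset.sum_le_sum fun S _ => hf S
    _ = ((Finset.univ.erase x).card.choose k) * D := by simp
    _ ≤ 2 ^ (Finset.univ.erase x).card * D := Nat.mul_le_mul_right _ (Nat.choose_le_two_pow _ _)
    _ < _ := by
      rw [← card_erase_succ x, pow_succ]
      have : 0 < 2 ^ (Finset.univ.erase x).card * D := by positivity
      linarith

include hp in
theorem countWithout_lt (x : X) (M : (X → Bool) → Bool) (k : ℕ) :
    countWithout p e x M k < 2 ^ Fintype.card X * commonDen p :=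
  sum_powersetCard_lt x k _ (commonDen_pos p) fun S =>
    totalWeight_fixedWeight hp e S ▸ weightedCount_le _ M

include hp in
theorem countWith_lt (x : X) (M : (X → Bool) → Bool) (k : ℕ) :
    countWith p e x M k < 2 ^ Fintype.card X * commonDen p :=
  sum_powersetCard_lt x k (fun S => weightedCount (fixedWeight p e (insert x S)) M)
    (commonDen_pos p) fun S => totalWeight_fixedWeight hp e (insert x S) ▸ weightedCount_le _ M

theorem sum_powerset_erase (x : X) {R : Type*} [AddCommMonoid R] (f : Finset X → R) :
    ∑ S ∈ (Finset.univ.erase x).powerset, f S =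
      ∑ k ∈ Finset.range (Fintype.card X),
        ∑ S ∈ (Finset.univ.erase x).powersetCard k, f S := by
  rw [Finset.sum_powerset, card_erase_succ]

/-- Split the subsets by whether they contain `x`, and then by the number of other elements: each of
these contributes `Z`, and `x` contributes `Y`. -/
theorem weightedCount_mixedWeight_eq_digits (p : X → ℚ) (e : X → Bool) (x : X)
    (M : (X → Bool) → Bool) (Z Y : ℕ) :
    weightedCount (mixedWeight p e fun y => if y = x then Y else Z) M =
      ∑ k ∈ Finset.range (Fintype.card X), countWithout p e x M k * Z ^ k +
        Y * ∑ k ∈ Finset.range (Fintype.card X), countWith p e x M k * Z ^ k := by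
  rw [weightedCount_mixedWeight, ← Finset.insert_erase (Finset.mem_univ x),
    Finset.sum_powerset_insert (Finset.notMem_erase x _), sum_powerset_erase, sum_powerset_erase,
    Finset.mul_sum]
  have hprod : ∀ k, ∀ S ∈ (Finset.univ.erase x).powersetCard k,
      ∏ y ∈ S, (if y = x then Y else Z) = Z ^ k := by
    intro k S hS
    obtain ⟨h1, h2⟩ := Finset.mem_powersetCard.1 hS
    rw [← h2, ← Finset.prod_const]
    exact Finset.prod_congr rfl fun y hy => if_neg (Finset.ne_of_mem_erase (h1 hy))
  congr 1
  · refine Finset.sum_congr rfl fun k _ => ?_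
    rw [countWithout, Finset.sum_mul]
    refine Finset.sum_congr rfl fun S hS => ?_
    rw [hprod k S hS, mul_comm]
  · refine Finset.sum_congr rfl fun k _ => ?_
    rw [countWith, Finset.sum_mul, Finset.mul_sum]
    refine Finset.sum_congr rfl fun S hS => ?_
    have hx : x ∉ S := fun h =>
      Finset.notMem_erase x _ ((Finset.mem_powersetCard.1 hS).1 h)
    rw [Finset.prod_insert hx, hprod k S hS, if_pos rfl]
    ring

include hp in
theorem shapScore_eq_div (x : X) (M : (X → Bool) → Bool) :
    shapScore p M e x =
      (((∑ k ∈ Finset.range (Fintype.card X),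
            k.factorial * (Fintype.card X - 1 - k).factorial * countWith p e x M k : ℕ) : ℚ) -
        ((∑ k ∈ Finset.range (Fintype.card X),
            k.factorial * (Fintype.card X - 1 - k).factorial * countWithout p e x M k : ℕ) : ℚ)) /
        ((commonDen p * (Fintype.card X).factorial : ℕ) : ℚ) := by
  have hD : (commonDen p : ℚ) ≠ 0 := by exact_mod_cast (commonDen_pos p).ne'
  have hF : ((Fintype.card X).factorial : ℚ) ≠ 0 := by
    exact_mod_cast (Nat.factorial_pos _).ne'
  rw [shapScore, sum_powerset_erase, eq_div_iff (by push_cast; positivity)]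
  push_cast
  rw [← Finset.sum_sub_distrib, Finset.sum_mul]
  refine Finset.sum_congr rfl fun k _ => ?_
  rw [countWith, countWithout, ← mul_sub, Nat.cast_sum, Nat.cast_sum, ← Finset.sum_sub_distrib,
    Finset.sum_mul, Finset.mul_sum]
  refine Finset.sum_congr rfl fun S hS => ?_
  rw [condExpectation_eq hp, condExpectation_eq hp, (Finset.mem_powersetCard.1 hS).2,
    Nat.sub_right_comm]
  field_simp

/-- Reading off a digit in base `b`. -/
theorem sum_mul_pow_div_mod {b : ℕ} (n : ℕ) (c : ℕ → ℕ) (hc : ∀ k, c k < b) {i : ℕ}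
    (hi : i < n) : (∑ k ∈ Finset.range n, c k * b ^ k) / b ^ i % b = c i := by
  have hb : 0 < b := (Nat.zero_le _).trans_lt (hc 0)
  induction i generalizing n c with
  | zero =>
    obtain ⟨n, rfl⟩ := Nat.exists_eq_add_of_lt hi
    rw [Finset.sum_range_succ']
    have : b ∣ ∑ k ∈ Finset.range (0 + n), c (k + 1) * b ^ (k + 1) :=
      Finset.dvd_sum fun k _ => Dvd.dvd.mul_left (dvd_pow_self b k.succ_ne_zero) _
    rw [pow_zero, mul_one, Nat.div_one, Nat.add_mod, Nat.mod_eq_zero_of_dvd this, zero_add,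
      Nat.mod_mod, Nat.mod_eq_of_lt (hc 0)]
  | succ i ih =>
    obtain ⟨n, rfl⟩ := Nat.exists_eq_add_of_lt hi
    have h := ih (i + 1 + n) (fun k => c (k + 1)) (fun k => hc _) (by omega)
    rw [Finset.sum_range_succ', pow_succ', ← Nat.div_div_eq_div_mul]
    have : ∑ k ∈ Finset.range (i + 1 + n), c (k + 1) * b ^ (k + 1) =
        b * ∑ k ∈ Finset.range (i + 1 + n), c (k + 1) * b ^ k := by
      rw [Finset.mul_sum]; exact Finset.sum_congr rfl fun k _ => by ring
    rw [this, pow_zero, mul_one, Nat.mul_add_div hb, Nat.div_eq_of_lt (hc 0), add_zero, h]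

theorem sum_mul_pow_lt {b : ℕ} (n : ℕ) (c : ℕ → ℕ) (hc : ∀ k, c k < b) :
    ∑ k ∈ Finset.range n, c k * b ^ k < b ^ n := by
  induction n with
  | zero => simp
  | succ n ih =>
    rw [Finset.sum_range_succ, pow_succ]
    have := Nat.mul_le_mul_right (b ^ n) (Nat.succ_le_of_lt (hc n))
    rw [Nat.succ_mul] at this
    linarith [mul_comm b (b ^ n)]

end ShapCount

/-! ## Reasoning about random-access machine programs -/

namespace RamExpr

/-- A coefficient that bounds the value and the cost of an expression linearly. -/
def weight : RamExpr → ℕ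
  | lit c => Nat.size c + 1
  | read _ i => 2 * i.weight + 2
  | add a b => 2 * (a.weight + b.weight) + 1
  | sub a b => 2 * (a.weight + b.weight) + 1
  | mul a b => 2 * (a.weight + b.weight) + 1
  | div a b => 2 * (a.weight + b.weight) + 1

theorem size_add_le (a b : ℕ) : Nat.size (a + b) ≤ Nat.size a + Nat.size b + 1 := by
  rw [Nat.size_le]
  have ha := Nat.lt_size_self a
  have hb := Nat.lt_size_self b
  have ha' : 2 ^ Nat.size a ≤ 2 ^ (Nat.size a + Nat.size b) :=
    Nat.pow_le_pow_right (by norm_num) (by omega)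
  have hb' : 2 ^ Nat.size b ≤ 2 ^ (Nat.size a + Nat.size b) :=
    Nat.pow_le_pow_right (by norm_num) (by omega)
  rw [pow_succ]; omega

theorem size_mul_le (a b : ℕ) : Nat.size (a * b) ≤ Nat.size a + Nat.size b := by
  rw [Nat.size_le, pow_add]
  exact Nat.mul_lt_mul'' (Nat.lt_size_self a) (Nat.lt_size_self b)

/-- Each operation at most adds the lengths of its operands, up to one digit, so a fixed expression
has length and cost linear in `L`. Intermediate values may exceed `2 ^ L`; only memory contents must
stay below. -/
theorem size_and_cost_le {L : ℕ} (hL : 1 ≤ L) {σ : RamMemory} (hσ : ∀ k i, σ k i < 2 ^ L)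
    (a : RamExpr) : Nat.size (a.value σ) ≤ a.weight * L ∧ a.cost σ ≤ a.weight * L := by
  induction a with
  | lit c =>
    have h : Nat.size c + 1 ≤ (Nat.size c + 1) * L := Nat.le_mul_of_pos_right _ hL
    exact ⟨(Nat.le_succ _).trans h, h⟩
  | read k i ih =>
    have h := Nat.size_le.2 (hσ k (i.value σ))
    constructor
    · simp only [value, weight]; nlinarith
    · simp only [cost, weight]; nlinarith
  | add a b iha ihb =>
    have h := size_add_le (a.value σ) (b.value σ)
    constructor
    · simp only [value, weight]; nlinarith
    · simp only [cost, weight]; nlinarith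
  | sub a b iha ihb =>
    have h : Nat.size (a.value σ - b.value σ) ≤ _ := Nat.size_le_size (Nat.sub_le _ _)
    constructor
    · simp only [value, weight]; nlinarith
    · simp only [cost, weight]; nlinarith
  | mul a b iha ihb =>
    have h := size_mul_le (a.value σ) (b.value σ)
    constructor
    · simp only [value, weight]; nlinarith
    · simp only [cost, weight]; nlinarith
  | div a b iha ihb =>
    have h : Nat.size (a.value σ / b.value σ) ≤ _ := Nat.size_le_size (Nat.div_le_self _ _)
    constructor
    · simp only [value, weight]; nlinarith
    · simp only [cost, weight]; nlinarith

end RamExpr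

namespace RamProg

/-- The arrays that a program writes to. -/
def writes : RamProg → List ℕ
  | skip => []
  | write k _ _ => [k]
  | seq c d => c.writes ++ d.writes
  | branch _ c d => c.writes ++ d.writes
  | loop _ c => c.writes

open Polynomial in
/-- If every loop makes at most `L` iterations and all numbers stay below `2 ^ L`, the running
time is at most `L` times the value of this polynomial at `L`. -/
noncomputable def timeBound : RamProg → ℕ[X]
  | skip => C 1
  | write _ i a => C (2 * (i.weight + a.weight) + 1)
  | seq c d => c.timeBound + d.timeBound
  | branch a c d => C (a.weight + 1) + c.timeBound + d.timeBound
  | loop a c => (X + 1) * (C (a.weight + 1) + c.timeBound)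

end RamProg

theorem RamExec.eq_of_notMem_writes {c : RamProg} {σ τ : RamMemory} {t : ℕ}
    (h : RamExec c σ τ t) {k : ℕ} (hk : k ∉ c.writes) : τ k = σ k := by
  induction h with
  | skip => rfl
  | write k' i a σ =>
    have : k ≠ k' := by simpa [RamProg.writes] using hk
    simp [this]
  | seq _ _ ih1 ih2 =>
    simp only [RamProg.writes, List.mem_append, not_or] at hk
    rw [ih2 hk.2, ih1 hk.1]
  | branch_true _ _ ih =>
    simp only [RamProg.writes, List.mem_append, not_or] at hk
    exact ih hk.1
  | branch_false _ _ ih =>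
    simp only [RamProg.writes, List.mem_append, not_or] at hk
    exact ih hk.2
  | loop_done => rfl
  | loop_step _ _ _ ih1 ih2 => rw [ih2 hk, ih1 hk]

/-- Started in `σ` with all numbers below `2 ^ L`, the program `c` halts within the time given by
its `timeBound`, with all numbers below `2 ^ L`, in a memory that satisfies `Q`. -/
def Runs (L : ℕ) (c : RamProg) (σ : RamMemory) (Q : RamMemory → Prop) : Prop :=
  (∀ k i, σ k i < 2 ^ L) → ∃ τ t, RamExec c σ τ t ∧ t ≤ c.timeBound.eval L * L ∧
    (∀ k i, τ k i < 2 ^ L) ∧ Q τ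

namespace Runs

variable {L : ℕ} {σ : RamMemory} {Q R : RamMemory → Prop} {c d : RamProg}

/-- The memory after writing `v` to cell `i` of array `k`. -/
abbrev put (σ : RamMemory) (k i v : ℕ) : RamMemory :=
  Function.update σ k (Function.update (σ k) i v)

theorem mono (h : Runs L c σ Q) (hQ : ∀ τ, Q τ → R τ) : Runs L c σ R := fun hσ =>
  let ⟨τ, t, h1, h2, h3, h4⟩ := h hσ
  ⟨τ, t, h1, h2, h3, hQ τ h4⟩

/-- Frame rule: what is known about arrays outside `c.writes` survives the execution of `c`. -/
theorem frame (h : Runs L c σ Q) :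
    Runs L c σ fun τ => (∀ k, k ∉ c.writes → τ k = σ k) ∧ (∀ k i, τ k i < 2 ^ L) ∧ Q τ :=
  fun hσ =>
  let ⟨τ, t, h1, h2, h3, h4⟩ := h hσ
  ⟨τ, t, h1, h2, h3, fun _ hk => h1.eq_of_notMem_writes hk, h3, h4⟩

theorem of_bounded_post (h : Runs L c σ fun τ => (∀ k i, τ k i < 2 ^ L) → Q τ) : Runs L c σ Q :=
  fun hσ =>
  let ⟨τ, t, h1, h2, h3, h4⟩ := h hσ
  ⟨τ, t, h1, h2, h3, h4 h3⟩

theorem of_bounded (h : (∀ k i, σ k i < 2 ^ L) → Runs L c σ Q) : Runs L c σ Q := fun hσ => h hσ hσ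

theorem skip (hL : 1 ≤ L) (h : Q σ) : Runs L .skip σ Q := fun hσ =>
  ⟨σ, 1, .skip σ, by simpa [RamProg.timeBound] using hL, hσ, h⟩

theorem write (hL : 1 ≤ L) {k : ℕ} {i a : RamExpr} (ha : a.value σ < 2 ^ L)
    (h : Q (put σ k (i.value σ) (a.value σ))) : Runs L (.write k i a) σ Q := fun hσ => by
  refine ⟨_, _, .write k i a σ, ?_, fun k' j => ?_, h⟩
  · have hi := i.size_and_cost_le hL hσ
    have ha := a.size_and_cost_le hL hσ
    simp only [RamProg.timeBound, Polynomial.eval_C]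
    nlinarith
  · by_cases hk : k' = k
    · subst hk
      by_cases hj : j = i.value σ
      · subst hj; simpa using ha
      · simpa [hj] using hσ _ j
    · simpa [hk] using hσ k' j

theorem seq (h : Runs L c σ fun τ => Runs L d τ Q) : Runs L (.seq c d) σ Q := fun hσ => by
  obtain ⟨τ, s, h1, h2, h3, h4⟩ := h hσ
  obtain ⟨υ, t, h5, h6, h7, h8⟩ := h4 h3
  refine ⟨υ, _, .seq h1 h5, ?_, h7, h8⟩
  rw [RamProg.timeBound, Polynomial.eval_add, add_mul]
  exact add_le_add h2 h6

theorem branch (hL : 1 ≤ L) {a : RamExpr} (h1 : a.value σ ≠ 0 → Runs L c σ Q)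
    (h2 : a.value σ = 0 → Runs L d σ Q) : Runs L (.branch a c d) σ Q := fun hσ => by
  have ha := a.size_and_cost_le hL hσ
  by_cases h : a.value σ = 0
  · obtain ⟨τ, t, h3, h4, h5, h6⟩ := h2 h hσ
    refine ⟨τ, _, .branch_false h h3, ?_, h5, h6⟩
    simp only [RamProg.timeBound, Polynomial.eval_add, Polynomial.eval_C]
    nlinarith
  · obtain ⟨τ, t, h3, h4, h5, h6⟩ := h1 h hσ
    refine ⟨τ, _, .branch_true h h3, ?_, h5, h6⟩
    simp only [RamProg.timeBound, Polynomial.eval_add, Polynomial.eval_C]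
    nlinarith

/-- The index of the invariant is a budget of remaining iterations. Every iteration consumes one
unit, so at budget `0` the guard must be false; starting from `N ≤ L` gives the factor `L + 1` in
`timeBound`. -/
theorem loop (hL : 1 ≤ L) {a : RamExpr} (I : ℕ → RamMemory → Prop) {N : ℕ} (hN : N ≤ L)
    (h0 : I N σ) (hdone : ∀ j τ, I j τ → a.value τ = 0 → Q τ)
    (hstep : ∀ j τ, I j τ → a.value τ ≠ 0 →
      ∃ i, j = i + 1 ∧ Runs L c τ (I i)) : Runs L (.loop a c) σ Q := fun hσ => by
  have key : ∃ τ t, RamExec (.loop a c) σ τ t ∧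
      t ≤ (N + 1) * ((a.weight + 1) + c.timeBound.eval L) * L ∧
      (∀ k i, τ k i < 2 ^ L) ∧ Q τ := by
    clear hN
    induction N generalizing σ with
    | zero =>
      have ha := a.size_and_cost_le hL hσ
      by_cases h : a.value σ = 0
      · refine ⟨σ, _, .loop_done h, ?_, hσ, hdone _ _ h0 h⟩
        nlinarith
      · obtain ⟨i, hi, -⟩ := hstep _ _ h0 h
        omega
    | succ N ih =>
      have ha := a.size_and_cost_le hL hσ
      by_cases h : a.value σ = 0
      · refine ⟨σ, _, .loop_done h, ?_, hσ, hdone _ _ h0 h⟩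
        nlinarith [Nat.zero_le (N * ((a.weight + 1) + c.timeBound.eval L) * L)]
      · obtain ⟨i, hi, hr⟩ := hstep _ _ h0 h
        obtain rfl : N = i := by omega
        obtain ⟨τ, s, h1, h2, h3, h4⟩ := hr hσ
        obtain ⟨υ, t, h5, h6, h7, h8⟩ := ih h4 h3
        refine ⟨υ, _, .loop_step h h1 h5, ?_, h7, h8⟩
        nlinarith
  obtain ⟨τ, t, h1, h2, h3, h4⟩ := key
  refine ⟨τ, t, h1, h2.trans ?_, h3, h4⟩
  simp only [RamProg.timeBound, Polynomial.eval_mul, Polynomial.eval_add, Polynomial.eval_C,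
    Polynomial.eval_X, Polynomial.eval_one]
  gcongr

end Runs

namespace RamExpr

/-- The variable kept in cell `0` of array `k`. -/
def var (k : ℕ) : RamExpr := read k (lit 0)

@[simp] theorem value_lit (σ : RamMemory) (c : ℕ) : (lit c).value σ = c := rfl
@[simp] theorem value_var (σ : RamMemory) (k : ℕ) : (var k).value σ = σ k 0 := rfl
@[simp] theorem value_read (σ : RamMemory) (k : ℕ) (i : RamExpr) :
    (read k i).value σ = σ k (i.value σ) := rfl
@[simp] theorem value_add (σ : RamMemory) (a b : RamExpr) :
    (add a b).value σ = a.value σ + b.value σ := rfl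
@[simp] theorem value_sub (σ : RamMemory) (a b : RamExpr) :
    (sub a b).value σ = a.value σ - b.value σ := rfl
@[simp] theorem value_mul (σ : RamMemory) (a b : RamExpr) :
    (mul a b).value σ = a.value σ * b.value σ := rfl
@[simp] theorem value_div (σ : RamMemory) (a b : RamExpr) :
    (div a b).value σ = a.value σ / b.value σ := rfl

end RamExpr

namespace RamProg

/-- Assignment to the variable kept in cell `0` of array `k`. -/
def assign (k : ℕ) (a : RamExpr) : RamProg := write k (.lit 0) a

/-- Run `c` for all values `0, …, N - 1` of the variable `k`. -/
def forLoop (k : ℕ) (N : RamExpr) (c : RamProg) : RamProg :=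
  seq (assign k (.lit 0))
    (loop (.sub N (.var k)) (seq c (assign k (.add (.var k) (.lit 1)))))

end RamProg

namespace Runs

variable {L : ℕ} {σ : RamMemory} {Q : RamMemory → Prop} {c : RamProg}

theorem assign (hL : 1 ≤ L) {k : ℕ} {a : RamExpr} (ha : a.value σ < 2 ^ L)
    (h : Q (put σ k 0 (a.value σ))) : Runs L (.assign k a) σ Q := write hL ha h

/-- The rule for bounded loops.  The invariant `I j` holds before the iteration with value `j` of
the loop variable, and does not depend on that variable. -/
theorem forLoop (hL : 1 ≤ L) {k : ℕ} {N : RamExpr} (I : ℕ → RamMemory → Prop) (n : ℕ) (hn : n ≤ L)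
    (hI : ∀ j τ v, I j τ → I j (put τ k 0 v)) (hk : k ∉ c.writes)
    (hN : ∀ τ : RamMemory, (∀ k', k' ≠ k → k' ∉ c.writes → τ k' = σ k') → N.value τ = n)
    (h0 : I 0 σ)
    (hstep : ∀ j < n, ∀ τ : RamMemory, (∀ k', k' ≠ k → k' ∉ c.writes → τ k' = σ k') →
      τ k 0 = j → (∀ k i, τ k i < 2 ^ L) → I j τ → Runs L c τ (I (j + 1)))
    (hQ : ∀ τ, (∀ k', k' ≠ k → k' ∉ c.writes → τ k' = σ k') → I n τ → Q τ) :
    Runs L (.forLoop k N c) σ Q := by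
  have hL2 : L < 2 ^ L := Nat.lt_two_pow_self
  refine seq (assign hL (by simp) ?_)
  -- The budget `r` counts down while the loop variable, equal to `n - r`, counts up. The loop
  -- variable never exceeds `n ≤ L < 2 ^ L`.
  let J : ℕ → RamMemory → Prop := fun r τ =>
    (∀ k', k' ≠ k → k' ∉ c.writes → τ k' = σ k') ∧ r ≤ n ∧ τ k 0 = n - r ∧ I (n - r) τ ∧
      (∀ k i, τ k i < 2 ^ L)
  intro hσ
  refine loop hL J hn ⟨fun k' h _ => by simp [h], le_rfl, by simp, ?_, hσ⟩ ?_ ?_ hσ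
  · rw [Nat.sub_self]; exact hI _ _ _ h0
  · rintro r τ ⟨h1, h2, h3, h4, -⟩ h5
    rw [RamExpr.value_sub, hN τ h1, RamExpr.value_var, h3] at h5
    obtain rfl : r = 0 := by omega
    exact hQ τ h1 h4
  · rintro r τ ⟨h1, h2, h3, h4, h4'⟩ h5
    rw [RamExpr.value_sub, hN τ h1, RamExpr.value_var, h3] at h5
    obtain ⟨r, rfl⟩ : ∃ r', r = r' + 1 := Nat.exists_eq_succ_of_ne_zero (by omega)
    refine ⟨r, rfl, seq ((hstep _ (by omega) τ h1 h3 h4' h4).frame.mono ?_)⟩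
    rintro υ ⟨h6, -, h7⟩
    have hval : (RamExpr.add (.var k) (.lit 1)).value υ = n - r := by
      simp only [RamExpr.value_add, RamExpr.value_var, RamExpr.value_lit, h6 k hk, h3]
      omega
    refine of_bounded_post (assign hL (by rw [hval]; omega) fun hξ => ?_)
    refine ⟨fun k' hk' hc => ?_, by omega, by simp [hval], ?_, hξ⟩
    · simp only [put, Function.update_of_ne hk']
      rw [h6 k' hc, h1 k' hk' hc]
    · have : n - (r + 1) + 1 = n - r := by omega
      rw [this] at h7
      exact hI _ _ _ h7

end Runs

/-! ## The layout of the input -/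

theorem length_flatMap_finRange {α : Type*} {n k : ℕ} (f : Fin n → List α)
    (hf : ∀ i, (f i).length = k) : ((List.finRange n).flatMap f).length = k * n := by
  simp [List.length_flatMap, hf, mul_comm]

theorem getD_flatMap_finRange {α : Type*} {n k : ℕ} (f : Fin n → List α)
    (hf : ∀ i, (f i).length = k) (i : Fin n) {j : ℕ} (hj : j < k) (d : α) (l : List α) :
    ((List.finRange n).flatMap f ++ l).getD (k * i + j) d = (f i).getD j d := by
  induction n with
  | zero => exact i.elim0
  | succ n ih =>
    rw [List.finRange_succ, List.flatMap_cons, List.append_assoc, List.flatMap_map]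
    cases i using Fin.cases with
    | zero =>
      simp only [Fin.val_zero, mul_zero, zero_add]
      rw [List.getD_append _ _ _ _ (by rw [hf]; exact hj)]
    | succ i =>
      rw [List.getD_append_right _ _ _ _ (by rw [hf, Fin.val_succ, mul_add]; omega), hf,
        ← ih (fun i => f i.succ) (fun i => hf _) i]
      congr 1
      rw [Fin.val_succ, mul_add]
      omega

theorem getD_append_flatMap_finRange {α : Type*} {n k : ℕ} (f : Fin n → List α)
    (hf : ∀ i, (f i).length = k) (j : ℕ) (d : α) (l : List α) :
    ((List.finRange n).flatMap f ++ l).getD (k * n + j) d = l.getD j d := by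
  have h := length_flatMap_finRange f hf
  rw [List.getD_append_right _ _ _ _ (by omega), h]
  congr 1
  omega

theorem GateLabel.length_encode {n : ℕ} (l : GateLabel (Fin n)) : l.encode.length = 2 := by
  cases l <;> rfl

namespace ShapInput

variable (I : ShapInput)

/-- The content of array `0` at the start of the computation. -/
def tape : ℕ → ℕ := ramInput I.encode 0

/-- The offset `3` skips the length of the input, `n` and `m`. The entity is rewritten as a
`flatMap` of singletons so that every section consists of blocks of constant length, whose addresses
are computable. -/
theorem tape_add_three (j : ℕ) : I.tape (3 + j) =
    ((List.finRange I.m).flatMap (fun g => (I.C.label g).encode)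
    ++ ((List.finRange I.m).flatMap
        (fun g => (List.finRange I.m).map fun g' => (I.C.wire g g').toNat)
    ++ ((List.finRange I.n).flatMap (fun y => encodeRat (I.p y))
    ++ ((List.finRange I.n).flatMap (fun y => [(I.e y).toNat])
    ++ [(I.x : ℕ)])))).getD j 0 := by
  simp only [tape, ramInput, encode, if_true, List.append_assoc,
    List.map_eq_flatMap (f := fun y => (I.e y).toNat), add_comm 3 j]
  rfl

theorem tape_one : I.tape 1 = I.n := by simp [tape, ramInput, encode]

theorem tape_two : I.tape 2 = I.m := by simp [tape, ramInput, encode]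

theorem tape_label (g : Fin I.m) {j : ℕ} (hj : j < 2) :
    I.tape (3 + (2 * g + j)) = (I.C.label g).encode.getD j 0 := by
  rw [tape_add_three, getD_flatMap_finRange _ (fun _ => GateLabel.length_encode _) _ hj]

theorem tape_wire (g h : Fin I.m) :
    I.tape (3 + (2 * I.m + (I.m * g + h))) = (I.C.wire g h).toNat := by
  rw [tape_add_three, getD_append_flatMap_finRange _ (fun _ => GateLabel.length_encode _),
    getD_flatMap_finRange _ (k := I.m) (by simp) _ h.2]
  simp

theorem tape_marginal (y : Fin I.n) {j : ℕ} (hj : j < 3) :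
    I.tape (3 + (2 * I.m + (I.m * I.m + (3 * y + j)))) = (encodeRat (I.p y)).getD j 0 := by
  rw [tape_add_three, getD_append_flatMap_finRange _ (fun _ => GateLabel.length_encode _),
    getD_append_flatMap_finRange _ (k := I.m) (by simp),
    getD_flatMap_finRange _ (k := 3) (by simp [encodeRat]) _ hj]

theorem tape_entity (y : Fin I.n) :
    I.tape (3 + (2 * I.m + (I.m * I.m + (3 * I.n + y)))) = (I.e y).toNat := by
  rw [tape_add_three, getD_append_flatMap_finRange _ (fun _ => GateLabel.length_encode _),
    getD_append_flatMap_finRange _ (k := I.m) (by simp),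
    getD_append_flatMap_finRange _ (k := 3) (by simp [encodeRat])]
  have h := getD_flatMap_finRange (fun y => [(I.e y).toNat]) (fun _ => rfl) y zero_lt_one 0
    [(I.x : ℕ)]
  simpa using h

theorem tape_feature :
    I.tape (3 + (2 * I.m + (I.m * I.m + (3 * I.n + I.n)))) = I.x := by
  rw [tape_add_three, getD_append_flatMap_finRange _ (fun _ => GateLabel.length_encode _),
    getD_append_flatMap_finRange _ (k := I.m) (by simp),
    getD_append_flatMap_finRange _ (k := 3) (by simp [encodeRat])]
  simp

/-! ## The numbers that occur in the computation -/

/-- A base in which the counts of a given number of fixed features are digits. -/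
def base : ℕ := 2 ^ I.n * commonDen I.p

/-- The factors that keep track of the fixed features. -/
def marker (y : Fin I.n) : ℕ := if y = I.x then I.base ^ I.n else I.base

/-- The weights with which the gates are evaluated. -/
def wt : Fin I.n → Bool → ℕ := mixedWeight I.p I.e I.marker

/-- The total weight accepted by the gate `g`. -/
noncomputable def gateCount (g : Fin I.m) : ℕ := weightedCount I.wt fun u => I.C.eval u g

theorem base_pos : 0 < I.base := Nat.mul_pos (by positivity) (commonDen_pos _)

theorem wt_add (hp : ∀ y, 0 ≤ I.p y ∧ I.p y ≤ 1) (y : Fin I.n) :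
    I.wt y true + I.wt y false = (I.p y).den * (1 + I.marker y) := by
  have := num_natAbs_le_den hp y
  cases he : I.e y <;> simp [wt, mixedWeight, entityWeight, marginalWeight, he, mul_add] <;> omega

theorem totalWeight_wt (hp : ∀ y, 0 ≤ I.p y ∧ I.p y ≤ 1) :
    totalWeight I.wt = ∏ y, (I.p y).den * (1 + I.marker y) :=
  Finset.prod_congr rfl fun y _ => I.wt_add hp y

theorem totalWeight_wt_pos (hp : ∀ y, 0 ≤ I.p y ∧ I.p y ≤ 1) : 0 < totalWeight I.wt := by
  rw [I.totalWeight_wt hp]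
  exact Finset.prod_pos fun y _ => Nat.mul_pos (I.p y).den_pos (by omega)

/-- The weighted sum of the counts with the feature of interest fixed. -/
noncomputable def positivePart : ℕ :=
  ∑ k ∈ Finset.range I.n, k.factorial * (I.n - 1 - k).factorial *
    countWith I.p I.e I.x I.C.classifier k

/-- The weighted sum of the counts with the feature of interest not fixed. -/
noncomputable def negativePart : ℕ :=
  ∑ k ∈ Finset.range I.n, k.factorial * (I.n - 1 - k).factorial *
    countWithout I.p I.e I.x I.C.classifier k

/-- The denominator of the score before reduction. -/
def scoreDen : ℕ := commonDen I.p * I.n.factorial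

theorem scoreDen_pos : 0 < I.scoreDen := Nat.mul_pos (commonDen_pos _) (Nat.factorial_pos _)

theorem score_eq_div (hp : ∀ y, 0 ≤ I.p y ∧ I.p y ≤ 1) :
    I.score = ((I.positivePart : ℚ) - (I.negativePart : ℚ)) / (I.scoreDen : ℚ) := by
  rw [score, shapScore_eq_div hp]
  simp only [Fintype.card_fin, positivePart, negativePart, scoreDen]

/-- All numbers in the computation are below `2 ^ L`, and all loops have at most `L` iterations. -/
structure Fits (L : ℕ) : Prop where
  one_le : 1 ≤ L
  n_le : I.n ≤ L
  m_le : I.m ≤ L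
  base_lt : I.base ^ I.n < 2 ^ L
  total_lt : totalWeight I.wt < 2 ^ L
  factorial_lt : I.n.factorial < 2 ^ L
  score_lt : (2 * (I.n * (I.n.factorial * I.n.factorial * I.base)) + I.scoreDen) * I.scoreDen
    < 2 ^ L

theorem n_pos : 0 < I.n := (Nat.zero_le _).trans_lt I.x.2

end ShapInput

/-! ## The program -/

namespace ShapProgram

open RamExpr RamProg

/-- The number of features. -/
def nE : RamExpr := read 0 (lit 1)
/-- The number of gates. -/
def mE : RamExpr := read 0 (lit 2)
/-- The tag of the label of gate `g`. -/
def tagE (g : RamExpr) : RamExpr := read 0 (add (lit 3) (add (mul (lit 2) g) (lit 0)))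
/-- The argument of the label of gate `g`. -/
def argE (g : RamExpr) : RamExpr := read 0 (add (lit 3) (add (mul (lit 2) g) (lit 1)))
/-- Whether there is an edge from `g` to `h`. -/
def wireE (g h : RamExpr) : RamExpr :=
  read 0 (add (lit 3) (add (mul (lit 2) mE) (add (mul mE g) h)))
/-- The part of the input after the circuit. -/
def tailE (i : RamExpr) : RamExpr :=
  read 0 (add (lit 3) (add (mul (lit 2) mE) (add (mul mE mE) i)))
/-- The numerator of the marginal of `y`. -/
def numE (y : RamExpr) : RamExpr := tailE (add (mul (lit 3) y) (lit 1))
/-- The denominator of the marginal of `y`. -/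
def denE (y : RamExpr) : RamExpr := tailE (add (mul (lit 3) y) (lit 2))
/-- The value of the entity at `y`. -/
def entityE (y : RamExpr) : RamExpr := tailE (add (mul (lit 3) nE) y)
/-- The feature of interest. -/
def featureE : RamExpr := tailE (add (mul (lit 3) nE) nE)

section Values

variable {I : ShapInput} {σ : RamMemory} (hσ : σ 0 = I.tape)

include hσ

theorem value_nE : nE.value σ = I.n := by simp [nE, hσ, I.tape_one]

theorem value_mE : mE.value σ = I.m := by simp [mE, hσ, I.tape_two]

theorem value_tagE {a : RamExpr} (g : Fin I.m) (hg : a.value σ = g) :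
    (tagE a).value σ = (I.C.label g).encode.getD 0 0 := by
  rw [← I.tape_label g (by norm_num)]
  simp [tagE, hσ, hg]

theorem value_argE {a : RamExpr} (g : Fin I.m) (hg : a.value σ = g) :
    (argE a).value σ = (I.C.label g).encode.getD 1 0 := by
  rw [← I.tape_label g (by norm_num)]
  simp [argE, hσ, hg]

theorem value_wireE {a b : RamExpr} (g h : Fin I.m) (hg : a.value σ = g) (hh : b.value σ = h) :
    (wireE a b).value σ = (I.C.wire g h).toNat := by
  rw [← I.tape_wire g h]
  simp [wireE, value_mE hσ, hσ, hg, hh]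

theorem value_tailE (a : RamExpr) :
    (tailE a).value σ = I.tape (3 + (2 * I.m + (I.m * I.m + a.value σ))) := by
  simp [tailE, value_mE hσ, hσ]

theorem value_numE {a : RamExpr} (y : Fin I.n) (hy : a.value σ = y) :
    (numE a).value σ = (I.p y).num.natAbs := by
  rw [numE, value_tailE hσ, value_add, value_mul, value_lit, value_lit, hy,
    I.tape_marginal y (by norm_num)]
  rfl

theorem value_denE {a : RamExpr} (y : Fin I.n) (hy : a.value σ = y) :
    (denE a).value σ = (I.p y).den := by
  rw [denE, value_tailE hσ, value_add, value_mul, value_lit, value_lit, hy,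
    I.tape_marginal y (by norm_num)]
  rfl

theorem value_entityE {a : RamExpr} (y : Fin I.n) (hy : a.value σ = y) :
    (entityE a).value σ = (I.e y).toNat := by
  rw [entityE, value_tailE hσ, value_add, value_mul, value_lit, value_nE hσ, hy, I.tape_entity]

theorem value_featureE : featureE.value σ = I.x := by
  rw [featureE, value_tailE hσ, value_add, value_mul, value_lit, value_nE hσ, I.tape_feature]

end Values

open Runs

variable {I : ShapInput} {L : ℕ} {σ : RamMemory}

/-- The product over the features below `i`. -/
def prefixProd {n : ℕ} (f : Fin n → ℕ) (i : ℕ) : ℕ := ∏ y : Fin n, if (y : ℕ) < i then f y else 1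

theorem prefixProd_zero {n : ℕ} (f : Fin n → ℕ) : prefixProd f 0 = 1 := by simp [prefixProd]

theorem prefixProd_self {n : ℕ} (f : Fin n → ℕ) : prefixProd f n = ∏ y, f y := by
  simp [prefixProd]

theorem prefixProd_succ {n : ℕ} (f : Fin n → ℕ) (y : Fin n) :
    prefixProd f (y + 1) = prefixProd f y * f y := by
  simp only [prefixProd]
  rw [← Finset.mul_prod_erase _ _ (Finset.mem_univ y),
    ← Finset.mul_prod_erase Finset.univ (fun i : Fin n => if (i : ℕ) < y then f i else 1)
      (Finset.mem_univ y)]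
  simp only [Nat.lt_succ_self, if_true, lt_irrefl, if_false, one_mul]
  rw [mul_comm]
  congr 1
  refine Finset.prod_congr rfl fun i hi => ?_
  have : (i : ℕ) ≠ y := fun h => Finset.ne_of_mem_erase hi (Fin.ext h)
  exact if_congr (by omega) rfl rfl

/-- As all factors are positive, partial products never exceed the final one, so a bound on the
final value covers the whole loop. -/
theorem prefixProd_le {n : ℕ} (f : Fin n → ℕ) (hf : ∀ y, 0 < f y) (i : ℕ) :
    prefixProd f i ≤ ∏ y, f y :=
  Finset.prod_le_prod' fun y _ => by
    have := hf y
    split_ifs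
    · exact le_rfl
    · exact this

/-- Compute the common denominator (array `2`) and the base (array `3`). -/
def scales : RamProg :=
  seq (assign 2 (lit 1)) <| seq (assign 3 (lit 1)) <|
    forLoop 9 nE <|
      seq (assign 2 (mul (var 2) (denE (var 9))))
        (assign 3 (mul (var 3) (mul (lit 2) (denE (var 9)))))

theorem prod_two_mul_den (I : ShapInput) : ∏ y, 2 * (I.p y).den = I.base := by
  rw [Finset.prod_mul_distrib, Finset.prod_const, Finset.card_univ, Fintype.card_fin]
  rfl

theorem base_lt (hL : I.Fits L) : I.base < 2 ^ L :=
  (Nat.le_self_pow I.n_pos.ne' _).trans_lt hL.base_lt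

theorem runs_scales (hL : I.Fits L) (hσ : σ 0 = I.tape) :
    Runs L scales σ fun τ => τ 2 0 = commonDen I.p ∧ τ 3 0 = I.base := by
  have h1 : 1 < 2 ^ L := Nat.one_lt_two_pow (by have := hL.one_le; omega)
  refine seq (assign hL.one_le h1 (seq (assign hL.one_le h1 ?_)))
  refine Runs.forLoop hL.one_le (fun i τ => τ 2 0 = prefixProd (fun y => (I.p y).den) i ∧
    τ 3 0 = prefixProd (fun y => 2 * (I.p y).den) i) I.n hL.n_le ?_ ?_ ?_ ?_ ?_ ?_
  · intro j τ v h; simpa using h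
  · decide
  · intro τ h
    exact value_nE (by rw [h 0 (by decide) (by decide)]; simpa using hσ)
  · simp [prefixProd_zero]
  · rintro j hj τ h hτ - ⟨h2, h3⟩
    have h0 : τ 0 = I.tape := by rw [h 0 (by decide) (by decide)]; simpa using hσ
    have hy := prefixProd_succ (fun y => (I.p y).den) ⟨j, hj⟩
    have hz := prefixProd_succ (fun y => 2 * (I.p y).den) ⟨j, hj⟩
    simp only at hy hz
    have hbd := prefixProd_le (fun y => 2 * (I.p y).den)
      (fun y => Nat.mul_pos two_pos (I.p y).den_pos) (j + 1)
    rw [prod_two_mul_den] at hbd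
    have hbd' := prefixProd_le (fun y => (I.p y).den) (fun y => (I.p y).den_pos) (j + 1)
    have hDZ : ∏ y, (I.p y).den ≤ I.base := Nat.le_mul_of_pos_left _ (by positivity)
    have hB := base_lt hL
    have hd := value_denE h0 (a := var 9) ⟨j, hj⟩ hτ
    have hd' : ∀ v, (denE (var 9)).value (put τ 2 0 v) = (I.p ⟨j, hj⟩).den := fun v =>
      value_denE (by simpa using h0) ⟨j, hj⟩ (by simpa using hτ)
    refine seq (assign hL.one_le ?_ (assign hL.one_le ?_ ?_))
    · rw [value_mul, hd, value_var, h2, ← hy]; omega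
    · simp only [value_mul, hd', value_lit, value_var]
      simp [h3]; omega
    · simp [hd, hd', h2, h3, hy, hz]
  · rintro τ - ⟨h2, h3⟩
    rw [prefixProd_self] at h2 h3
    exact ⟨h2, by rw [h3, prod_two_mul_den]⟩

/-- Compute the power of the base that marks the feature of interest (array `4`). -/
def topPower : RamProg :=
  seq (assign 4 (lit 1)) <| forLoop 9 nE <| assign 4 (mul (var 4) (var 3))

theorem runs_topPower (hL : I.Fits L) (hσ : σ 0 = I.tape) (h3 : σ 3 0 = I.base) :
    Runs L topPower σ fun τ => τ 4 0 = I.base ^ I.n := by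
  have h1 : 1 < 2 ^ L := Nat.one_lt_two_pow (by have := hL.one_le; omega)
  refine seq (assign hL.one_le h1 ?_)
  refine Runs.forLoop hL.one_le (fun i τ => τ 4 0 = I.base ^ i) I.n hL.n_le ?_ ?_ ?_ ?_ ?_ ?_
  · intro j τ v h; simpa using h
  · decide
  · intro τ h
    exact value_nE (by rw [h 0 (by decide) (by decide)]; simpa using hσ)
  · simp
  · rintro j hj τ h hτ - h4
    have h3' : τ 3 0 = I.base := by rw [h 3 (by decide) (by decide)]; simpa using h3
    refine assign hL.one_le ?_ ?_
    · rw [value_mul, value_var, value_var, h4, h3', ← pow_succ]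
      exact (Nat.pow_le_pow_right I.base_pos hj).trans_lt hL.base_lt
    · simp [h4, h3', pow_succ]
  · rintro τ - h
    exact h

/-- Compute the markers (array `6`) and the total weight (array `5`). -/
def markers : RamProg :=
  seq (assign 5 (lit 1)) <| forLoop 9 nE <|
    seq (branch (add (sub (var 9) featureE) (sub featureE (var 9)))
      (write 6 (var 9) (var 3)) (write 6 (var 9) (var 4))) <|
    assign 5 (mul (var 5) (mul (denE (var 9)) (add (lit 1) (read 6 (var 9)))))

theorem runs_markers (hp : ∀ y, 0 ≤ I.p y ∧ I.p y ≤ 1) (hL : I.Fits L) (hσ : σ 0 = I.tape)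
    (h3 : σ 3 0 = I.base) (h4 : σ 4 0 = I.base ^ I.n) :
    Runs L markers σ fun τ => τ 5 0 = totalWeight I.wt ∧ ∀ y : Fin I.n, τ 6 y = I.marker y := by
  have h1 : 1 < 2 ^ L := Nat.one_lt_two_pow (by have := hL.one_le; omega)
  refine seq (assign hL.one_le h1 ?_)
  refine Runs.forLoop hL.one_le (fun i τ =>
    τ 5 0 = prefixProd (fun y => (I.p y).den * (1 + I.marker y)) i ∧
    ∀ y : Fin I.n, (y : ℕ) < i → τ 6 y = I.marker y) I.n hL.n_le ?_ ?_ ?_ ?_ ?_ ?_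
  · intro j τ v h; simpa using h
  · decide
  · intro τ h
    exact value_nE (by rw [h 0 (by decide) (by decide)]; simpa using hσ)
  · simp [prefixProd_zero]
  · rintro j hj τ h hτ - ⟨h5, h6⟩
    have h0 : τ 0 = I.tape := by rw [h 0 (by decide) (by decide)]; simpa using hσ
    have h3' : τ 3 0 = I.base := by rw [h 3 (by decide) (by decide)]; simpa using h3
    have h4' : τ 4 0 = I.base ^ I.n := by rw [h 4 (by decide) (by decide)]; simpa using h4
    have hy := prefixProd_succ (fun y => (I.p y).den * (1 + I.marker y)) ⟨j, hj⟩
    simp only at hy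
    have hle := prefixProd_le (fun y => (I.p y).den * (1 + I.marker y))
      (fun y => Nat.mul_pos (I.p y).den_pos (by omega)) (j + 1)
    rw [← I.totalWeight_wt hp] at hle
    have hT := hL.total_lt
    have key : Runs L (branch (add (sub (var 9) featureE) (sub featureE (var 9)))
        (write 6 (var 9) (var 3)) (write 6 (var 9) (var 4))) τ
        (· = put τ 6 j (I.marker ⟨j, hj⟩)) := by
      -- The sum of the two truncated differences vanishes exactly when the loop variable is the
      -- feature of interest.
      refine branch hL.one_le (fun hne => ?_) fun heq => ?_
      · have : (⟨j, hj⟩ : Fin I.n) ≠ I.x := by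
          rintro h
          simp [value_featureE h0, hτ, ← h] at hne
        have hm : I.marker ⟨j, hj⟩ = I.base := if_neg this
        refine write hL.one_le ?_ ?_
        · rw [value_var, h3']; exact base_lt hL
        · simp [h3', hτ, hm]
      · have : (⟨j, hj⟩ : Fin I.n) = I.x := by
          simp only [value_add, value_sub, value_featureE h0, hτ, value_var] at heq
          exact Fin.ext (by simp only; omega)
        have hm : I.marker ⟨j, hj⟩ = I.base ^ I.n := if_pos this
        refine write hL.one_le ?_ ?_
        · rw [value_var, h4']; exact hL.base_lt
        · simp [h4', hτ, hm]
    refine seq (key.mono ?_)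
    rintro υ rfl
    have hval : (mul (var 5) (mul (denE (var 9)) (add (lit 1) (read 6 (var 9))))).value
        (put τ 6 j (I.marker ⟨j, hj⟩)) =
        prefixProd (fun y => (I.p y).den * (1 + I.marker y)) (j + 1) := by
      rw [value_mul, value_mul, value_denE (I := I) (by simpa using h0) ⟨j, hj⟩ (by simpa using hτ)]
      simp [h5, hτ, hy]
    refine assign hL.one_le (by rw [hval]; omega) ?_
    rw [hval]
    refine ⟨by simp, fun y hyj => ?_⟩
    by_cases hyj' : (y : ℕ) = j
    · obtain rfl : y = ⟨j, hj⟩ := Fin.ext hyj'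
      simp
    · have := h6 y (by omega)
      simpa [hyj'] using this
  · rintro τ - ⟨h5, h6⟩
    rw [prefixProd_self, ← I.totalWeight_wt hp] at h5
    exact ⟨h5, fun y => h6 y y.2⟩

end ShapProgram

/-! ### Recurrences for the gate counts, and the rank of a gate -/

namespace ShapInput

variable (I : ShapInput)

/-- The input gates of `g` with index below `i`. -/
def preds (g : Fin I.m) (i : ℕ) : Finset (Fin I.m) := {h | (h : ℕ) < i ∧ I.C.wire h g = true}

theorem mem_preds {g h : Fin I.m} {i : ℕ} :
    h ∈ I.preds g i ↔ (h : ℕ) < i ∧ I.C.wire h g = true := by simp [preds]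

theorem preds_zero (g : Fin I.m) : I.preds g 0 = ∅ := by simp [preds]

theorem preds_succ_of_wire {g h : Fin I.m} (hw : I.C.wire h g = true) :
    I.preds g (h + 1) = insert h (I.preds g h) := by
  ext k
  simp only [Finset.mem_insert, mem_preds, Fin.ext_iff]
  constructor
  · rintro ⟨h1, h2⟩
    by_cases hk : (k : ℕ) = h
    · exact .inl hk
    · exact .inr ⟨by omega, h2⟩
  · rintro (h1 | h1)
    · rw [Fin.ext h1]; exact ⟨by omega, hw⟩
    · exact ⟨by omega, h1.2⟩

theorem preds_succ_of_not_wire {g h : Fin I.m} (hw : I.C.wire h g = false) :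
    I.preds g (h + 1) = I.preds g h := by
  ext k
  simp only [mem_preds]
  refine ⟨fun ⟨h1, h2⟩ => ⟨?_, h2⟩, fun ⟨h1, h2⟩ => ⟨by omega, h2⟩⟩
  have : (k : ℕ) ≠ h := fun hk => by rw [Fin.ext hk, hw] at h2; cases h2
  omega

variable {I}

theorem count_conj_insert (hD : I.C.Decomposable) {g h : Fin I.m} (hg : I.C.label g = .and)
    (hw : I.C.wire h g = true) :
    weightedCount I.wt (I.C.conj (I.preds g h)) * I.gateCount h =
      weightedCount I.wt (I.C.conj (I.preds g (h + 1))) * totalWeight I.wt := by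
  rw [preds_succ_of_wire I hw]
  refine I.C.weightedCount_conj_insert I.wt fun k hk => ?_
  obtain ⟨h1, h2⟩ := (mem_preds I).1 hk
  exact hD g hg k h h2 hw fun hkh => by rw [hkh] at h1; omega

/-- A negation gate is included because its only input forms a one-element disjunction, for which
disjointness is vacuous. -/
theorem count_disj_insert (hD : I.C.Deterministic) {g h : Fin I.m}
    (hg : I.C.label g = .or ∨ I.C.label g = .not) (hw : I.C.wire h g = true) :
    weightedCount I.wt (I.C.disj (I.preds g (h + 1))) =
      weightedCount I.wt (I.C.disj (I.preds g h)) + I.gateCount h := by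
  rw [preds_succ_of_wire I hw]
  refine I.C.weightedCount_disj_insert I.wt fun k hk => ?_
  obtain ⟨h1, h2⟩ := (mem_preds I).1 hk
  have hkh : k ≠ h := fun hkh => by rw [hkh] at h1; omega
  rcases hg with hg | hg
  · exact hD g hg k h h2 hw hkh
  · exact absurd ((I.C.fanin_not g hg).unique h2 hw) hkh

theorem gateCount_and {g : Fin I.m} (hg : I.C.label g = .and) :
    I.gateCount g = weightedCount I.wt (I.C.conj (I.preds g I.m)) := by
  rw [gateCount]; congr 1; funext u
  rw [BooleanCircuit.eval_eq, hg]
  simp [BooleanCircuit.conj, mem_preds]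

theorem gateCount_or {g : Fin I.m} (hg : I.C.label g = .or) :
    I.gateCount g = weightedCount I.wt (I.C.disj (I.preds g I.m)) := by
  rw [gateCount]; congr 1; funext u
  rw [BooleanCircuit.eval_eq, hg]
  simp [BooleanCircuit.disj, mem_preds]

theorem gateCount_not {g : Fin I.m} (hg : I.C.label g = .not) :
    I.gateCount g = totalWeight I.wt - weightedCount I.wt (I.C.disj (I.preds g I.m)) := by
  rw [← weightedCount_not I.wt (I.C.disj (I.preds g I.m)), Nat.add_sub_cancel, gateCount]
  congr 1; funext u
  rw [BooleanCircuit.eval_eq, hg]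
  simp [BooleanCircuit.disj, mem_preds, ← decide_not]

theorem gateCount_const {g : Fin I.m} {b : Bool} (hg : I.C.label g = .const b) :
    I.gateCount g = totalWeight I.wt * b.toNat := by
  have : (fun u => I.C.eval u g) = fun _ => b := by
    funext u; rw [BooleanCircuit.eval_eq, hg]
  rw [gateCount, this]
  cases b
  · simp [weightedCount_false]
  · simp [weightedCount_true]

/-- The division is exact by `weightedCount_apply`: the divisor is the factor of `y` in the total
weight, and the second factor of the dividend is the weight of the value `true` at `y`. -/
theorem gateCount_var (hp : ∀ y, 0 ≤ I.p y ∧ I.p y ≤ 1) {g : Fin I.m} {y : Fin I.n}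
    (hg : I.C.label g = .var y) :
    totalWeight I.wt *
        ((I.e y).toNat * ((I.p y).den * I.marker y) + (I.p y).num.natAbs) /
      ((I.p y).den * (1 + I.marker y)) = I.gateCount g := by
  have h : (fun u => I.C.eval u g) = fun u => u y := by
    funext u; rw [BooleanCircuit.eval_eq, hg]
  refine Nat.div_eq_of_eq_mul_left (Nat.mul_pos (I.p y).den_pos (by omega)) ?_
  rw [gateCount, h, ← I.wt_add hp, weightedCount_apply]
  congr 1
  cases he : I.e y <;> simp [wt, mixedWeight, entityWeight, marginalWeight, he]

theorem gateCount_le (g : Fin I.m) : I.gateCount g ≤ totalWeight I.wt := weightedCount_le _ _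

open Classical in
/-- The number of gates with a nonempty path to `g`. -/
noncomputable def rank (g : Fin I.m) : ℕ :=
  Finset.card {h : Fin I.m | Relation.TransGen (fun a b => I.C.wire a b = true) h g}

/-- Everything that reaches `h` reaches `g`, and `h` itself reaches `g` but, by acyclicity, not `h`.
-/
theorem rank_lt_rank {g h : Fin I.m} (hw : I.C.wire h g = true) : rank h < rank g := by
  classical
  refine Finset.card_lt_card ⟨fun k hk => ?_, fun hs => ?_⟩
  · simp only [Finset.mem_filter, Finset.mem_univ, true_and] at hk ⊢
    exact hk.tail hw
  · have := @hs h (Finset.mem_filter.2 ⟨Finset.mem_univ _, .single hw⟩)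
    simp only [Finset.mem_filter, Finset.mem_univ, true_and] at this
    exact I.C.acyclic h this

theorem rank_lt (g : Fin I.m) : rank g < I.m := by
  classical
  have : rank g < (Finset.univ : Finset (Fin I.m)).card := by
    refine Finset.card_lt_card ⟨Finset.subset_univ _, fun hs => ?_⟩
    have := hs (Finset.mem_univ g)
    simp only [Finset.mem_filter, Finset.mem_univ, true_and] at this
    exact I.C.acyclic g this
  simpa using this

end ShapInput

/-! ### Evaluating the circuit on the machine -/

namespace ShapProgram

open RamExpr RamProg Runs

variable {I : ShapInput} {L : ℕ} {σ : RamMemory}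

/-- Combine the counts of the inputs of gate `g` (index in array `11`, counts in array `7`) as for
a conjunction (array `13`) and as for a disjunction (array `14`). -/
def combineInputs : RamProg :=
  seq (assign 13 (var 5)) <| seq (assign 14 (lit 0)) <| forLoop 12 mE <|
    branch (wireE (var 12) (var 11))
      (seq (assign 13 (div (mul (var 13) (read 7 (var 12))) (var 5)))
        -- With truncated subtraction, `T - (T - a)` is `min T a`: the running sum is capped at the
        -- total weight.
        (assign 14 (sub (var 5) (sub (var 5) (add (var 14) (read 7 (var 12)))))))
      skip

/-- The bounds hold unconditionally, because early rounds work with counts that are still wrong and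
both combinations are formed whatever the label. The quotient is bounded since both factors are at
most the total weight, the sum since it is capped. When the input counts are correct, the cap
changes nothing and the division is exact. -/
theorem runs_combineInputs (hI : I ∈ shapInstances) (hL : I.Fits L) (hσ : σ 0 = I.tape)
    (h5 : σ 5 0 = totalWeight I.wt) (h7 : ∀ h : Fin I.m, σ 7 h ≤ totalWeight I.wt)
    (g : Fin I.m) (h11 : σ 11 0 = g) :
    Runs L combineInputs σ fun τ => τ 13 0 ≤ totalWeight I.wt ∧ τ 14 0 ≤ totalWeight I.wt ∧
      ((∀ h, I.C.wire h g = true → σ 7 h = I.gateCount h) →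
        (I.C.label g = .and → τ 13 0 = weightedCount I.wt (I.C.conj (I.preds g I.m))) ∧
        (I.C.label g = .or ∨ I.C.label g = .not →
          τ 14 0 = weightedCount I.wt (I.C.disj (I.preds g I.m)))) := by
  obtain ⟨hdet, hdec, hp⟩ := hI
  have hT := hL.total_lt
  have hTpos := I.totalWeight_wt_pos hp
  refine seq (assign hL.one_le (by rwa [value_var, h5])
    (seq (assign hL.one_le (by simp) ?_)))
  refine Runs.forLoop hL.one_le (fun i τ => τ 13 0 ≤ totalWeight I.wt ∧
      τ 14 0 ≤ totalWeight I.wt ∧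
      ((∀ h, I.C.wire h g = true → σ 7 h = I.gateCount h) →
        (I.C.label g = .and → τ 13 0 = weightedCount I.wt (I.C.conj (I.preds g i))) ∧
        (I.C.label g = .or ∨ I.C.label g = .not →
          τ 14 0 = weightedCount I.wt (I.C.disj (I.preds g i))))) I.m hL.m_le ?_ ?_ ?_ ?_ ?_ ?_
  · intro j τ v h; simpa using h
  · decide
  · intro τ h
    exact value_mE (by rw [h 0 (by decide) (by decide)]; simpa using hσ)
  · simp [h5, I.preds_zero, BooleanCircuit.weightedCount_conj_empty,
      BooleanCircuit.weightedCount_disj_empty]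
  · rintro j hj τ h hτ - ⟨h13, h14, hc⟩
    have h0 : τ 0 = I.tape := by rw [h 0 (by decide) (by decide)]; simpa using hσ
    have h5' : τ 5 0 = totalWeight I.wt := by rw [h 5 (by decide) (by decide)]; simpa using h5
    have h7' : τ 7 = σ 7 := by rw [h 7 (by decide) (by decide)]; simp
    have h11' : τ 11 0 = g := by rw [h 11 (by decide) (by decide)]; simpa using h11
    have hw := value_wireE h0 (a := var 12) (b := var 11) ⟨j, hj⟩ g hτ h11'
    refine branch hL.one_le (fun hne => ?_) fun heq => ?_
    · rw [hw] at hne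
      have hw' : I.C.wire ⟨j, hj⟩ g = true := by
        cases hb : I.C.wire ⟨j, hj⟩ g
        · simp [hb] at hne
        · rfl
      have hle : τ 13 0 * σ 7 j / totalWeight I.wt ≤ totalWeight I.wt := by
        refine Nat.div_le_of_le_mul (Nat.mul_le_mul h13 (h7 ⟨j, hj⟩))
      refine seq (assign hL.one_le ?_ (assign hL.one_le ?_ ?_))
      · simp only [value_div, value_mul, value_var, value_read, hτ, h7', h5']
        omega
      · simp only [value_sub, value_var]
        rw [show put τ 13 0 _ 5 0 = τ 5 0 by simp, h5']
        omega
      · simp only [value_div, value_mul, value_var, value_read, value_sub, value_add, hτ, h7', h5',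
          put, Function.update_self, ne_eq, Nat.reduceEqDiff,
          not_false_eq_true, Function.update_of_ne]
        refine ⟨hle, Nat.sub_le _ _, fun hpred => ⟨fun hand => ?_, fun hor => ?_⟩⟩
        · rw [(hc hpred).1 hand, hpred ⟨j, hj⟩ hw', ShapInput.count_conj_insert hdec hand hw']
          exact Nat.mul_div_cancel _ hTpos
        · have h1 := ShapInput.count_disj_insert hdet hor hw'
          have h2 := weightedCount_le I.wt (I.C.disj (I.preds g (j + 1)))
          have h3 := hpred ⟨j, hj⟩ hw'
          simp only at h1 h3
          rw [(hc hpred).2 hor, h3, ← h1]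
          omega
    · rw [hw] at heq
      have hw' : I.C.wire ⟨j, hj⟩ g = false := by
        cases hb : I.C.wire ⟨j, hj⟩ g
        · rfl
        · simp [hb] at heq
      have := I.preds_succ_of_not_wire hw'
      simp only at this
      rw [this]
      exact Runs.skip hL.one_le ⟨h13, h14, hc⟩
  · rintro τ - h
    exact h

/-- Compute the count of gate `g` from the label of `g` and the combined counts of its inputs. -/
def storeCount : RamProg :=
  branch (tagE (var 11))
    (branch (sub (tagE (var 11)) (lit 1))
      (branch (sub (tagE (var 11)) (lit 2))
        (branch (sub (tagE (var 11)) (lit 3))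
          (write 7 (var 11) (sub (var 5) (var 14)))
          (write 7 (var 11) (var 14)))
        (write 7 (var 11) (var 13)))
      (write 7 (var 11) (mul (var 5) (argE (var 11)))))
    (write 7 (var 11) (div
      (mul (var 5) (add (mul (entityE (argE (var 11)))
          (mul (denE (argE (var 11))) (read 6 (argE (var 11)))))
        (numE (argE (var 11)))))
      (mul (denE (argE (var 11))) (add (lit 1) (read 6 (argE (var 11)))))))

/-- Once the smaller tags are excluded, the truncated difference of the tag and `i` vanishes only
for the tag `i`; thus nested tests single out the label. -/
theorem runs_storeCount (hI : I ∈ shapInstances) (hL : I.Fits L) (hσ : σ 0 = I.tape)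
    (h5 : σ 5 0 = totalWeight I.wt) (h6 : ∀ y : Fin I.n, σ 6 y = I.marker y)
    (g : Fin I.m) (h11 : σ 11 0 = g)
    (h13 : σ 13 0 ≤ totalWeight I.wt) (h14 : σ 14 0 ≤ totalWeight I.wt) :
    Runs L storeCount σ fun τ => ∃ v ≤ totalWeight I.wt, τ 7 = Function.update (σ 7) g v ∧
      ((I.C.label g = .and → σ 13 0 = weightedCount I.wt (I.C.conj (I.preds g I.m))) →
        (I.C.label g = .or ∨ I.C.label g = .not →
          σ 14 0 = weightedCount I.wt (I.C.disj (I.preds g I.m))) → v = I.gateCount g) := by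
  obtain ⟨hdet, hdec, hp⟩ := hI
  have hT := hL.total_lt
  have ht := value_tagE hσ (a := var 11) g h11
  have ha := value_argE hσ (a := var 11) g h11
  cases hl : I.C.label g with
  | var y =>
    rw [hl] at ht ha
    refine branch hL.one_le (fun h => absurd ht h) fun _ => ?_
    have hv : (div
      (mul (var 5) (add (mul (entityE (argE (var 11)))
          (mul (denE (argE (var 11))) (read 6 (argE (var 11)))))
        (numE (argE (var 11)))))
      (mul (denE (argE (var 11))) (add (lit 1) (read 6 (argE (var 11)))))).value σ
        = I.gateCount g := by
      rw [← I.gateCount_var hp hl]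
      simp only [value_div, value_mul, value_add, value_var, value_read, value_lit,
        value_entityE hσ y ha, value_denE hσ y ha, value_numE hσ y ha, h5]
      have ha' : (argE (var 11)).value σ = y := ha
      simp only [ha', h6]
    refine write hL.one_le (by rw [hv]; exact (I.gateCount_le g).trans_lt hT) ?_
    rw [hv]
    exact ⟨_, I.gateCount_le g, by simp [h11], fun _ _ => rfl⟩
  | const b =>
    rw [hl] at ht ha
    refine branch hL.one_le (fun _ => ?_) fun h => absurd (ht.symm.trans h) one_ne_zero
    refine branch hL.one_le (fun h => absurd ?_ h) fun _ => ?_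
    · rw [value_sub, ht]; rfl
    have hv : (mul (var 5) (argE (var 11))).value σ = I.gateCount g := by
      rw [value_mul, value_var, ha, h5, I.gateCount_const hl]; rfl
    refine write hL.one_le (by rw [hv]; exact (I.gateCount_le g).trans_lt hT) ?_
    rw [hv]
    exact ⟨_, I.gateCount_le g, by simp [h11], fun _ _ => rfl⟩
  | and =>
    rw [hl] at ht
    have ht' : (tagE (var 11)).value σ = 2 := ht
    refine branch hL.one_le (fun _ => ?_) fun h => absurd h (by simp [ht'])
    refine branch hL.one_le (fun _ => ?_) fun h => absurd h (by simp [ht'])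
    refine branch hL.one_le (fun h => absurd h (by simp [ht'])) fun _ => ?_
    refine write hL.one_le (by rw [value_var]; omega) ?_
    exact ⟨_, h13, by simp [h11], fun h _ => by rw [h rfl, I.gateCount_and hl]⟩
  | or =>
    rw [hl] at ht
    have ht' : (tagE (var 11)).value σ = 3 := ht
    refine branch hL.one_le (fun _ => ?_) fun h => absurd h (by simp [ht'])
    refine branch hL.one_le (fun _ => ?_) fun h => absurd h (by simp [ht'])
    refine branch hL.one_le (fun _ => ?_) fun h => absurd h (by simp [ht'])
    refine branch hL.one_le (fun h => absurd h (by simp [ht'])) fun _ => ?_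
    refine write hL.one_le (by rw [value_var]; omega) ?_
    exact ⟨_, h14, by simp [h11], fun _ h => by rw [h (.inl rfl), I.gateCount_or hl]⟩
  | not =>
    rw [hl] at ht
    have ht' : (tagE (var 11)).value σ = 4 := ht
    refine branch hL.one_le (fun _ => ?_) fun h => absurd h (by simp [ht'])
    refine branch hL.one_le (fun _ => ?_) fun h => absurd h (by simp [ht'])
    refine branch hL.one_le (fun _ => ?_) fun h => absurd h (by simp [ht'])
    refine branch hL.one_le (fun _ => ?_) fun h => absurd h (by simp [ht'])
    refine write hL.one_le (by rw [value_sub, value_var, h5]; omega) ?_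
    refine ⟨totalWeight I.wt - σ 14 0, Nat.sub_le _ _, by simp [h11, h5], fun _ h => ?_⟩
    rw [h (.inr rfl), I.gateCount_not hl]

/-- Recompute the count of gate `g`. -/
def updateGate : RamProg := seq combineInputs storeCount

theorem runs_updateGate (hI : I ∈ shapInstances) (hL : I.Fits L) (hσ : σ 0 = I.tape)
    (h5 : σ 5 0 = totalWeight I.wt) (h6 : ∀ y : Fin I.n, σ 6 y = I.marker y)
    (h7 : ∀ h : Fin I.m, σ 7 h ≤ totalWeight I.wt) (g : Fin I.m) (h11 : σ 11 0 = g) :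
    Runs L updateGate σ fun τ => ∃ v ≤ totalWeight I.wt, τ 7 = Function.update (σ 7) g v ∧
      ((∀ h, I.C.wire h g = true → σ 7 h = I.gateCount h) → v = I.gateCount g) := by
  refine seq ((runs_combineInputs hI hL hσ h5 h7 g h11).frame.mono ?_)
  rintro τ ⟨hf, -, h13, h14, hc⟩
  have h0 := hf 0 (by decide)
  have h5' := hf 5 (by decide)
  have h6' := hf 6 (by decide)
  have h7' := hf 7 (by decide)
  have h11' := hf 11 (by decide)
  refine (runs_storeCount hI hL (h0.trans hσ) (by rw [h5', h5]) (by rwa [h6']) g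
    (by rw [h11', h11]) h13 h14).mono ?_
  rintro υ ⟨v, hv, hu, hvc⟩
  exact ⟨v, hv, by rw [hu, h7'], fun h => hvc (hc h).1 (hc h).2⟩

/-- Recompute the counts of all gates as often as there are gates. -/
def evalGates : RamProg := forLoop 10 mE (forLoop 11 mE updateGate)

/-- After `r` rounds the counts of all gates of rank below `r` are correct, since the inputs of a
gate have smaller rank. Ranks are below `m`, so `m` rounds suffice and no topological sorting is
needed. -/
theorem runs_evalGates (hI : I ∈ shapInstances) (hL : I.Fits L) (hσ : σ 0 = I.tape)
    (h5 : σ 5 0 = totalWeight I.wt) (h6 : ∀ y : Fin I.n, σ 6 y = I.marker y)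
    (h7 : ∀ h : Fin I.m, σ 7 h = 0) :
    Runs L evalGates σ fun τ => ∀ g : Fin I.m, τ 7 g = I.gateCount g := by
  refine Runs.forLoop hL.one_le (fun r τ => (∀ g : Fin I.m, τ 7 g ≤ totalWeight I.wt) ∧
    ∀ g : Fin I.m, ShapInput.rank g < r → τ 7 g = I.gateCount g) I.m hL.m_le ?_ ?_ ?_ ?_ ?_ ?_
  · intro j τ v h; simpa using h
  · decide
  · intro τ h
    exact value_mE (by rw [h 0 (by decide) (by decide), hσ])
  · simp [h7]
  · rintro r hr τ h hτ - ⟨hle, hc⟩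
    -- During a sweep the gates of rank below `r` stay correct when recomputed, and those of rank
    -- `r` become correct once visited.
    refine Runs.forLoop hL.one_le (fun i υ => (∀ g : Fin I.m, υ 7 g ≤ totalWeight I.wt) ∧
      ∀ g : Fin I.m, (ShapInput.rank g < r ∨ (g : ℕ) < i ∧ ShapInput.rank g ≤ r) →
        υ 7 g = I.gateCount g) I.m hL.m_le ?_ ?_ ?_ ?_ ?_ ?_
    · intro j τ v h; simpa using h
    · decide
    · intro υ hυ
      exact value_mE (by rw [hυ 0 (by decide) (by decide), h 0 (by decide) (by decide), hσ])
    · exact ⟨hle, fun g hg => hc g (by simpa using hg)⟩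
    · rintro i hi υ hf hυ - ⟨hle', hc'⟩
      have e0 := (hf 0 (by decide) (by decide)).trans (h 0 (by decide) (by decide))
      have e5 := (hf 5 (by decide) (by decide)).trans (h 5 (by decide) (by decide))
      have e6 := (hf 6 (by decide) (by decide)).trans (h 6 (by decide) (by decide))
      refine (runs_updateGate hI hL (e0.trans hσ) (by rw [e5, h5]) (by rwa [e6]) hle' ⟨i, hi⟩
        hυ).mono ?_
      rintro ξ ⟨v, hv, hξ, hvc⟩
      rw [hξ]
      constructor
      · intro g
        by_cases hg : (g : ℕ) = i
        · simpa [hg] using hv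
        · simpa [hg] using hle' g
      · intro g hg
        by_cases hgi : (g : ℕ) = i
        · obtain rfl : g = ⟨i, hi⟩ := Fin.ext hgi
          rw [Function.update_self]
          refine hvc fun k hk => hc' k (.inl ?_)
          have := ShapInput.rank_lt_rank hk
          omega
        · rw [Function.update_of_ne hgi]
          exact hc' g (by omega)
    · rintro υ - ⟨h1, h2⟩
      exact ⟨h1, fun g hg => h2 g (.inr ⟨g.2, by omega⟩)⟩
  · rintro τ - ⟨-, h⟩
    exact fun g => h g (ShapInput.rank_lt g)

/-- Select the count of the output gate (array `15`). -/
def selectOutput : RamProg :=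
  forLoop 11 mE <| seq (assign 13 (lit 0)) <|
    seq (forLoop 12 mE (assign 13 (add (var 13) (wireE (var 11) (var 12))))) <|
      branch (var 13) skip (assign 15 (read 7 (var 11)))

/-- Array `13` counts the outgoing edges of the current gate. Only the output gate has none, so
array `15` is set once and never overwritten. -/
theorem runs_selectOutput (hL : I.Fits L) (hσ : σ 0 = I.tape)
    (h7 : ∀ g : Fin I.m, σ 7 g = I.gateCount g) :
    Runs L selectOutput σ fun τ => τ 15 0 = weightedCount I.wt I.C.classifier := by
  have hLL : L < 2 ^ L := Nat.lt_two_pow_self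
  have hml := hL.m_le
  refine Runs.forLoop hL.one_le (fun i τ => (I.C.output : ℕ) < i → τ 15 0 =
    weightedCount I.wt I.C.classifier) I.m hL.m_le ?_ ?_ ?_ ?_ ?_ ?_
  · intro j τ v h; simpa using h
  · decide
  · intro τ h
    exact value_mE (by rw [h 0 (by decide) (by decide), hσ])
  · simp
  · rintro j hj τ h hτ - hout
    have h0 : τ 0 = I.tape := by rw [h 0 (by decide) (by decide), hσ]
    have h7' : τ 7 = σ 7 := h 7 (by decide) (by decide)
    refine seq (assign hL.one_le (by simp) (seq ?_))
    have key : Runs L (.forLoop 12 mE (.assign 13 (add (var 13) (wireE (var 11) (var 12)))))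
        (put τ 13 0 ((lit 0).value τ))
        fun υ => υ 13 0 = 0 ↔ ∀ h : Fin I.m, I.C.wire ⟨j, hj⟩ h = false := by
      refine Runs.forLoop hL.one_le (fun i υ => υ 13 0 ≤ i ∧ (υ 13 0 = 0 ↔
        ∀ h : Fin I.m, (h : ℕ) < i → I.C.wire ⟨j, hj⟩ h = false)) I.m hL.m_le ?_ ?_ ?_ ?_ ?_ ?_
      · intro j τ v h; simpa using h
      · decide
      · intro υ hf
        exact value_mE (by rw [hf 0 (by decide) (by decide)]; simpa using h0)
      · simp
      · rintro i hi υ hf hυ - ⟨hle, hiff⟩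
        have h0' : υ 0 = I.tape := by rw [hf 0 (by decide) (by decide)]; simpa using h0
        have hw := value_wireE h0' (a := var 11) (b := var 12) ⟨j, hj⟩ ⟨i, hi⟩
          (by rw [value_var, hf 11 (by decide) (by decide)]; simpa using hτ) hυ
        have hb := Bool.toNat_le (I.C.wire ⟨j, hj⟩ ⟨i, hi⟩)
        refine assign hL.one_le (by rw [value_add, value_var, hw]; omega) ?_
        simp only [value_add, value_var, hw, put, Function.update_self]
        refine ⟨by omega, ?_⟩
        rw [Nat.add_eq_zero_iff, hiff]
        constructor
        · rintro ⟨h1, h2⟩ k hk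
          by_cases hki : (k : ℕ) = i
          · obtain rfl : k = ⟨i, hi⟩ := Fin.ext hki
            simpa using h2
          · exact h1 k (by omega)
        · intro h1
          exact ⟨fun k hk => h1 k (by omega), by simp [h1 ⟨i, hi⟩ (by simp)]⟩
      · rintro υ - ⟨-, h⟩
        rw [h]
        exact ⟨fun h k => h k k.2, fun h k _ => h k⟩
    refine key.frame.mono ?_
    rintro υ ⟨hf, -, hiff⟩
    have e15 : υ 15 = τ 15 := by rw [hf 15 (by decide)]; simp
    have e7 : υ 7 = σ 7 := by rw [hf 7 (by decide)]; simpa using h7'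
    have e11 : υ 11 0 = j := by rw [hf 11 (by decide)]; simpa using hτ
    have hspec := I.C.unique_output.choose_spec
    refine branch hL.one_le (fun hne => ?_) fun heq => ?_
    · refine Runs.skip hL.one_le fun hlt => ?_
      have : (I.C.output : ℕ) ≠ j := fun hj' => hne (hiff.2 (by
        have : (⟨j, hj⟩ : Fin I.m) = I.C.output := Fin.ext hj'.symm
        rw [this]
        exact hspec.1))
      rw [e15]
      exact hout (by omega)
    · have hj' : (⟨j, hj⟩ : Fin I.m) = I.C.output := hspec.2 _ (hiff.1 heq)
      have hv : (read 7 (var 11)).value υ = weightedCount I.wt I.C.classifier := by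
        rw [value_read, value_var, e11, e7, ← Fin.val_mk hj, h7, hj']
        rfl
      refine assign hL.one_le (by rw [hv]; exact (weightedCount_le _ _).trans_lt hL.total_lt) ?_
      rw [hv]
      simp
  · rintro τ - h
    exact h I.C.output.2

end ShapProgram

/-- The machine has only natural numbers: the sign is decided by whether `b - a` is nonzero, and the
absolute value of the difference is the sum of the two truncated differences. Dividing by the gcd is
`Rat.normalize`. -/
theorem encodeRat_sub_div (a b d : ℕ) (hd : 0 < d) :
    encodeRat (((a : ℚ) - b) / d) =
      [if b - a ≠ 0 then 1 else 0, ((a - b) + (b - a)) / Nat.gcd ((a - b) + (b - a)) d,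
        d / Nat.gcd ((a - b) + (b - a)) d] := by
  have hz : ((a : ℤ) - b).natAbs = (a - b) + (b - a) := by omega
  have hq : ((a : ℚ) - b) / d = Rat.normalize ((a : ℤ) - b) d hd.ne' := by
    rw [Rat.normalize_eq_mkRat, Rat.mkRat_eq_div]
    push_cast
    rfl
  have hneg : ((a : ℚ) - b) / d < 0 ↔ b - a ≠ 0 := by
    have hd' : (0 : ℚ) < d := by exact_mod_cast hd
    rw [div_lt_iff₀ hd', zero_mul, sub_neg, Nat.cast_lt]
    omega
  rw [encodeRat, if_congr hneg rfl rfl, hq, Rat.normalize_eq]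
  simp only [hz]
  rw [Int.natAbs_ediv_of_dvd, hz, Int.natAbs_natCast]
  exact Int.natCast_dvd.2 (by rw [hz]; exact Nat.gcd_dvd_left _ _)

/-! ### Digits of the count of the output gate -/

namespace ShapInput

variable {I : ShapInput}

theorem count_classifier_eq (I : ShapInput) :
    weightedCount I.wt I.C.classifier =
      ∑ k ∈ Finset.range I.n, countWithout I.p I.e I.x I.C.classifier k * I.base ^ k +
        I.base ^ I.n *
          ∑ k ∈ Finset.range I.n, countWith I.p I.e I.x I.C.classifier k * I.base ^ k := by
  have h := weightedCount_mixedWeight_eq_digits I.p I.e I.x I.C.classifier I.base (I.base ^ I.n)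
  rwa [Fintype.card_fin] at h

theorem countWithout_lt_base (hp : ∀ y, 0 ≤ I.p y ∧ I.p y ≤ 1) (k : ℕ) :
    countWithout I.p I.e I.x I.C.classifier k < I.base := by
  simpa [base] using countWithout_lt hp I.e I.x I.C.classifier k

theorem countWith_lt_base (hp : ∀ y, 0 ≤ I.p y ∧ I.p y ≤ 1) (k : ℕ) :
    countWith I.p I.e I.x I.C.classifier k < I.base := by
  simpa [base] using countWith_lt hp I.e I.x I.C.classifier k

/-- The marker `base ^ n` of `x` moves every set containing `x` above the lowest `n` digits, and the
remaining sum is too small to carry into them. -/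
theorem count_classifier_mod (hp : ∀ y, 0 ≤ I.p y ∧ I.p y ≤ 1) :
    weightedCount I.wt I.C.classifier % I.base ^ I.n =
      ∑ k ∈ Finset.range I.n, countWithout I.p I.e I.x I.C.classifier k * I.base ^ k := by
  rw [count_classifier_eq, Nat.add_mul_mod_self_left,
    Nat.mod_eq_of_lt (sum_mul_pow_lt _ _ (countWithout_lt_base hp))]

theorem count_classifier_div (hp : ∀ y, 0 ≤ I.p y ∧ I.p y ≤ 1) :
    weightedCount I.wt I.C.classifier / I.base ^ I.n =
      ∑ k ∈ Finset.range I.n, countWith I.p I.e I.x I.C.classifier k * I.base ^ k := by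
  rw [count_classifier_eq, Nat.add_mul_div_left _ _ (pow_pos I.base_pos _),
    Nat.div_eq_of_lt (sum_mul_pow_lt _ _ (countWithout_lt_base hp)), zero_add]

theorem sum_factorial_mul_le {c : ℕ → ℕ} (hc : ∀ k, c k < I.base) {i : ℕ} (hi : i ≤ I.n) :
    ∑ k ∈ Finset.range i, k.factorial * (I.n - 1 - k).factorial * c k ≤
      I.n * (I.n.factorial * I.n.factorial * I.base) := by
  calc _ ≤ ∑ k ∈ Finset.range i, I.n.factorial * I.n.factorial * I.base := by
        refine Finset.sum_le_sum fun k hk => ?_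
        have hk' := Finset.mem_range.1 hk
        exact Nat.mul_le_mul (Nat.mul_le_mul (Nat.factorial_le (by omega))
          (Nat.factorial_le (by omega))) (hc k).le
    _ ≤ _ := by
      rw [Finset.sum_const, Finset.card_range, smul_eq_mul]
      exact Nat.mul_le_mul_right _ hi

theorem Fits.sum_lt {L : ℕ} (hL : I.Fits L) :
    2 * (I.n * (I.n.factorial * I.n.factorial * I.base)) + I.scoreDen < 2 ^ L :=
  (Nat.le_mul_of_pos_right _ I.scoreDen_pos).trans_lt hL.score_lt

end ShapInput

/-! ### From the count to the reduced fraction -/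

namespace ShapProgram

open RamExpr RamProg Runs

variable {I : ShapInput} {L : ℕ} {σ : RamMemory}

/-- Compute the factorials up to that of the number of features (array `8`). -/
def factorials : RamProg :=
  seq (assign 8 (lit 1)) <| forLoop 9 nE <|
    write 8 (add (var 9) (lit 1)) (mul (read 8 (var 9)) (add (var 9) (lit 1)))

theorem runs_factorials (hL : I.Fits L) (hσ : σ 0 = I.tape) :
    Runs L factorials σ fun τ => ∀ i ≤ I.n, τ 8 i = i.factorial := by
  have h1 : 1 < 2 ^ L := Nat.one_lt_two_pow (by have := hL.one_le; omega)
  refine seq (assign hL.one_le h1 ?_)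
  refine Runs.forLoop hL.one_le (fun i τ => ∀ j ≤ i, τ 8 j = j.factorial) I.n hL.n_le
    ?_ ?_ ?_ ?_ ?_ ?_
  · intro j τ v h; simpa using h
  · decide
  · intro τ h
    exact value_nE (by rw [h 0 (by decide) (by decide)]; simpa using hσ)
  · simp
  · rintro j hj τ h hτ - h8
    have hv : (mul (read 8 (var 9)) (add (var 9) (lit 1))).value τ = (j + 1).factorial := by
      simp [hτ, h8 j le_rfl, Nat.factorial_succ, mul_comm]
    refine Runs.write hL.one_le ?_ ?_
    · rw [hv]; exact (Nat.factorial_le hj).trans_lt hL.factorial_lt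
    · rw [hv]
      intro i hi
      by_cases hij : i = j + 1
      · subst hij; simp [hτ]
      · have := h8 i (by omega)
        simpa [hτ, hij] using this
  · rintro τ - h
    exact h

/-- Split the count of the output gate into digits, and sum these with the coefficients of the
score (arrays `17` and `18`). -/
def sumDigits : RamProg :=
  seq (assign 16 (div (var 15) (var 4))) <|
  seq (assign 15 (sub (var 15) (mul (var 16) (var 4)))) <|
  seq (assign 17 (lit 0)) <| seq (assign 18 (lit 0)) <|
  forLoop 9 nE <|
    seq (assign 24 (mul (read 8 (var 9)) (read 8 (sub (sub nE (lit 1)) (var 9))))) <|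
    seq (assign 17 (add (var 17) (mul (var 24)
      (sub (var 16) (mul (div (var 16) (var 3)) (var 3)))))) <|
    seq (assign 18 (add (var 18) (mul (var 24)
      (sub (var 15) (mul (div (var 15) (var 3)) (var 3)))))) <|
    seq (assign 15 (div (var 15) (var 3))) (assign 16 (div (var 16) (var 3)))

theorem sub_div_mul_self (a b : ℕ) : a - a / b * b = a % b := by
  have := Nat.div_add_mod a b
  rw [mul_comm] at this
  omega

theorem runs_sumDigits (hp : ∀ y, 0 ≤ I.p y ∧ I.p y ≤ 1) (hL : I.Fits L) (hσ : σ 0 = I.tape)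
    (h3 : σ 3 0 = I.base) (h4 : σ 4 0 = I.base ^ I.n) (h8 : ∀ i ≤ I.n, σ 8 i = i.factorial)
    (h15 : σ 15 0 = weightedCount I.wt I.C.classifier) :
    Runs L sumDigits σ fun τ => τ 17 0 = I.positivePart ∧ τ 18 0 = I.negativePart := by
  have hn := I.n_pos
  have hW : weightedCount I.wt I.C.classifier < 2 ^ L :=
    (weightedCount_le _ _).trans_lt hL.total_lt
  have hs := hL.sum_lt
  refine seq (assign hL.one_le ?_ (seq (assign hL.one_le ?_
    (seq (assign hL.one_le (by simp) (seq (assign hL.one_le (by simp) ?_)))))))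
  · rw [value_div, value_var, value_var, h15]
    exact (Nat.div_le_self _ _).trans_lt hW
  · simp [h15]; omega
  refine Runs.forLoop hL.one_le (fun i τ =>
    τ 15 0 = weightedCount I.wt I.C.classifier % I.base ^ I.n / I.base ^ i ∧
    τ 16 0 = weightedCount I.wt I.C.classifier / I.base ^ I.n / I.base ^ i ∧
    τ 17 0 = ∑ k ∈ Finset.range i, k.factorial * (I.n - 1 - k).factorial *
      countWith I.p I.e I.x I.C.classifier k ∧
    τ 18 0 = ∑ k ∈ Finset.range i, k.factorial * (I.n - 1 - k).factorial *
      countWithout I.p I.e I.x I.C.classifier k) I.n hL.n_le ?_ ?_ ?_ ?_ ?_ ?_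
  · intro j τ v h; simpa using h
  · decide
  · intro τ h
    exact value_nE (by rw [h 0 (by decide) (by decide)]; simpa using hσ)
  · simp [h15, h4, sub_div_mul_self]
  · rintro j hj τ h hτ hbd ⟨e15, e16, e17, e18⟩
    have e0 : τ 0 = I.tape := by rw [h 0 (by decide) (by decide)]; simpa using hσ
    have e3 : τ 3 0 = I.base := by rw [h 3 (by decide) (by decide)]; simpa using h3
    have e8 : ∀ i ≤ I.n, τ 8 i = i.factorial := by
      rw [h 8 (by decide) (by decide)]; simpa using h8
    have hc : (mul (read 8 (var 9)) (read 8 (sub (sub nE (lit 1)) (var 9)))).value τ =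
        j.factorial * (I.n - 1 - j).factorial := by
      simp only [value_mul, value_read, value_sub, value_nE e0, value_var, value_lit, hτ]
      rw [e8 _ (by omega), e8 _ (by omega)]
    have d16 : τ 16 0 - τ 16 0 / I.base * I.base = countWith I.p I.e I.x I.C.classifier j := by
      rw [sub_div_mul_self, e16, ShapInput.count_classifier_div hp,
        sum_mul_pow_div_mod _ _ (ShapInput.countWith_lt_base hp) hj]
    have d15 : τ 15 0 - τ 15 0 / I.base * I.base =
        countWithout I.p I.e I.x I.C.classifier j := by
      rw [sub_div_mul_self, e15, ShapInput.count_classifier_mod hp,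
        sum_mul_pow_div_mod _ _ (ShapInput.countWithout_lt_base hp) hj]
    have b17 := ShapInput.sum_factorial_mul_le (ShapInput.countWith_lt_base hp)
      (Nat.succ_le_of_lt hj)
    have b18 := ShapInput.sum_factorial_mul_le (ShapInput.countWithout_lt_base hp)
      (Nat.succ_le_of_lt hj)
    rw [Finset.sum_range_succ, ← e17] at b17
    rw [Finset.sum_range_succ, ← e18] at b18
    have hbase : 0 < I.base := I.base_pos
    -- The coefficient is stored on its own, and the digit may be `0`, so the bounds on the partial
    -- sums do not cover it.
    have hcl : j.factorial * (I.n - 1 - j).factorial ≤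
        I.n * (I.n.factorial * I.n.factorial * I.base) := by
      calc _ ≤ I.n.factorial * I.n.factorial := Nat.mul_le_mul (Nat.factorial_le (by omega))
            (Nat.factorial_le (by omega))
        _ ≤ I.n.factorial * I.n.factorial * I.base := Nat.le_mul_of_pos_right _ hbase
        _ ≤ _ := Nat.le_mul_of_pos_left _ hn
    have v17 : (add (var 17) (mul (var 24)
        (sub (var 16) (mul (div (var 16) (var 3)) (var 3))))).value
        (put τ 24 0 (j.factorial * (I.n - 1 - j).factorial)) =
        τ 17 0 + j.factorial * (I.n - 1 - j).factorial *
          countWith I.p I.e I.x I.C.classifier j := by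
      simp [e3, d16]
    have v18 : ∀ v, (add (var 18) (mul (var 24)
        (sub (var 15) (mul (div (var 15) (var 3)) (var 3))))).value
        (put (put τ 24 0 (j.factorial * (I.n - 1 - j).factorial)) 17 0 v) =
        τ 18 0 + j.factorial * (I.n - 1 - j).factorial *
          countWithout I.p I.e I.x I.C.classifier j := by
      intro v
      simp [e3, d15]
    refine seq (assign hL.one_le (by rw [hc]; omega) ?_)
    rw [hc]
    refine seq (assign hL.one_le (by rw [v17]; omega) ?_)
    rw [v17]
    refine seq (assign hL.one_le (by rw [v18]; omega) ?_)
    rw [v18]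
    refine seq (assign hL.one_le ?_ (assign hL.one_le ?_ ?_))
    · simp [e3]
      exact (Nat.div_le_self _ _).trans_lt (hbd 15 0)
    · simp [e3]
      exact (Nat.div_le_self _ _).trans_lt (hbd 16 0)
    · simp [e3, e15, e16, e17, e18, Finset.sum_range_succ, Nat.div_div_eq_div_mul, pow_succ,
        mul_assoc]
  · rintro τ - ⟨-, -, h1, h2⟩
    exact ⟨h1, h2⟩

/-- Compute the absolute value of the numerator (array `21`), the denominator (array `22`), and
their greatest common divisor (array `19`). -/
def reduceFraction : RamProg :=
  seq (assign 21 (add (sub (var 17) (var 18)) (sub (var 18) (var 17)))) <|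
  seq (assign 22 (mul (var 2) (read 8 nE))) <|
  seq (assign 19 (add (var 21) (var 22))) <|
  seq (assign 20 (var 22)) <|
  loop (var 20) <|
    seq (assign 23 (sub (var 19) (mul (div (var 19) (var 20)) (var 20)))) <|
    seq (assign 19 (var 20)) (assign 20 (var 23))

/-- The product of the two entries at least halves in each iteration: if `0 < b ≤ a` then `b + a % b
≤ a`, hence `2 * (b * (a % b)) ≤ a * b`. A product below `2 ^ L` therefore allows at most `L`
iterations. -/
theorem runs_euclid (hL : 1 ≤ L) (h : σ 20 0 ≤ σ 19 0) (hlt : σ 19 0 * σ 20 0 < 2 ^ L) :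
    Runs L (.loop (var 20) <|
      .seq (.assign 23 (sub (var 19) (mul (div (var 19) (var 20)) (var 20)))) <|
      .seq (.assign 19 (var 20)) (.assign 20 (var 23))) σ
      fun τ => τ 19 0 = Nat.gcd (σ 19 0) (σ 20 0) := by
  refine of_bounded fun hσ => ?_
  refine Runs.loop hL (fun r τ => τ 20 0 ≤ τ 19 0 ∧ τ 19 0 * τ 20 0 < 2 ^ r ∧ τ 19 0 < 2 ^ L ∧
    Nat.gcd (τ 19 0) (τ 20 0) = Nat.gcd (σ 19 0) (σ 20 0)) le_rfl ⟨h, hlt, hσ 19 0, rfl⟩ ?_ ?_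
  · rintro r τ ⟨-, -, -, h4⟩ h0
    rw [value_var] at h0
    rwa [h0, Nat.gcd_zero_right] at h4
  · rintro r τ ⟨h1, h2, h3, h4⟩ h0
    rw [value_var] at h0
    have hpos : 0 < τ 20 0 := Nat.pos_of_ne_zero h0
    have hmod := Nat.mod_lt (τ 19 0) hpos
    have hhalf : 2 * (τ 20 0 * (τ 19 0 % τ 20 0)) ≤ τ 19 0 * τ 20 0 := by
      have h5 : τ 20 0 + τ 19 0 % τ 20 0 ≤ τ 19 0 := by
        have h6 := Nat.div_add_mod (τ 19 0) (τ 20 0)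
        have h7 : 1 ≤ τ 19 0 / τ 20 0 := Nat.div_pos h1 hpos
        nlinarith
      nlinarith
    obtain ⟨r, rfl⟩ : ∃ r', r = r' + 1 := by
      refine Nat.exists_eq_succ_of_ne_zero fun hr => ?_
      rw [hr, pow_zero] at h2
      have : 0 < τ 19 0 * τ 20 0 := Nat.mul_pos (by omega) hpos
      omega
    rw [pow_succ] at h2
    refine ⟨r, rfl, seq (assign hL ?_ (seq (assign hL ?_ (assign hL ?_ ?_))))⟩
    · simp only [value_sub, value_mul, value_div, value_var]; omega
    · simp; omega
    · simp; omega
    · simp only [value_sub, value_mul, value_div, value_var, sub_div_mul_self]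
      simp
      refine ⟨hmod.le, by omega, by omega, ?_⟩
      rw [← h4, Nat.gcd_comm (τ 19 0), Nat.gcd_rec (τ 20 0) (τ 19 0), Nat.gcd_comm]

theorem runs_reduceFraction (hp : ∀ y, 0 ≤ I.p y ∧ I.p y ≤ 1) (hL : I.Fits L)
    (hσ : σ 0 = I.tape)
    (h2 : σ 2 0 = commonDen I.p) (h8 : σ 8 I.n = I.n.factorial)
    (h17 : σ 17 0 = I.positivePart) (h18 : σ 18 0 = I.negativePart) :
    Runs L reduceFraction σ fun τ =>
      τ 21 0 = (I.positivePart - I.negativePart) + (I.negativePart - I.positivePart) ∧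
      τ 22 0 = I.scoreDen ∧ τ 19 0 = Nat.gcd (τ 21 0) (τ 22 0) := by
  have b1 : I.positivePart ≤ _ :=
    ShapInput.sum_factorial_mul_le (ShapInput.countWith_lt_base hp) le_rfl
  have b2 : I.negativePart ≤ _ :=
    ShapInput.sum_factorial_mul_le (ShapInput.countWithout_lt_base hp) le_rfl
  have hs := hL.sum_lt
  have v22 : ∀ v, (mul (var 2) (read 8 nE)).value (put σ 21 0 v) = I.scoreDen := fun v => by
    rw [value_mul, value_read, value_nE (I := I) (by simpa using hσ)]
    simp [h2, h8, ShapInput.scoreDen]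
  refine seq (assign hL.one_le (by simp [h17, h18]; omega) ?_)
  refine seq (assign hL.one_le (by rw [v22]; omega) ?_)
  rw [v22]
  refine seq (assign hL.one_le (by simp [h17, h18]; omega) ?_)
  refine seq (assign hL.one_le (by simp; omega) ?_)
  -- Euclid's algorithm starts from numerator plus denominator, which is at least the denominator,
  -- as required, and has the same gcd with it. The field `score_lt` bounds the resulting initial
  -- product.
  refine (runs_euclid hL.one_le (by simp) ?_).frame.mono ?_
  · simp [h17, h18]
    refine lt_of_le_of_lt (Nat.mul_le_mul_right _ ?_) hL.score_lt
    omega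
  · rintro τ ⟨hf, -, h⟩
    rw [hf 21 (by decide), hf 22 (by decide), h]
    simp [h17, h18]

/-- Write the output. -/
def writeScore : RamProg :=
  seq (write 1 (lit 0) (lit 3)) <|
  seq (branch (sub (var 18) (var 17)) (write 1 (lit 1) (lit 1)) (write 1 (lit 1) (lit 0))) <|
  seq (write 1 (lit 2) (div (var 21) (var 19))) (write 1 (lit 3) (div (var 22) (var 19)))

theorem runs_writeScore (hL : 2 ≤ L) {a b d : ℕ} (hd : 0 < d)
    (h17 : σ 17 0 = a) (h18 : σ 18 0 = b) (h21 : σ 21 0 = (a - b) + (b - a)) (h22 : σ 22 0 = d)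
    (h19 : σ 19 0 = Nat.gcd (σ 21 0) (σ 22 0)) :
    Runs L writeScore σ fun τ => RamOutput τ (encodeRat (((a : ℚ) - b) / d)) := by
  have hL1 : 1 ≤ L := by omega
  -- Room for the length `3` of the output list.
  have h4 : 2 ^ 2 ≤ 2 ^ L := Nat.pow_le_pow_right (by norm_num) hL
  refine of_bounded fun hσ => ?_
  refine seq (Runs.write hL1 (by rw [value_lit]; omega) ?_)
  rw [value_lit, value_lit]
  refine seq (Runs.mono (Q := (· = put (put σ 1 0 3) 1 1 (if b - a ≠ 0 then 1 else 0)))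
    (branch hL1 (fun h => ?_) fun h => ?_) ?_)
  · have : b - a ≠ 0 := by simpa [h17, h18] using h
    exact Runs.write hL1 (by rw [value_lit]; omega) (by simp only [value_lit, if_pos this])
  · have : ¬ (b - a ≠ 0) := by simpa [h17, h18] using h
    exact Runs.write hL1 (by rw [value_lit]; omega) (by simp only [value_lit, if_neg this])
  rintro τ rfl
  refine seq (Runs.write hL1 ?_ (Runs.write hL1 ?_ ?_))
  · simp only [value_div, value_var]
    exact (Nat.div_le_self _ _).trans_lt (by simpa using hσ 21 0)
  · simp only [value_div, value_var]
    exact (Nat.div_le_self _ _).trans_lt (by simpa using hσ 22 0)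
  · rw [encodeRat_sub_div a b d hd]
    intro i hi
    simp only [List.length_cons, List.length_nil] at hi
    rw [h21, h22] at h19
    obtain rfl | rfl | rfl | rfl : i = 0 ∨ i = 1 ∨ i = 2 ∨ i = 3 := by omega
    all_goals simp [h19, h21, h22]

end ShapProgram

/-! ## Polynomial bounds -/

theorem size_succ_le_inputLength {l : List ℕ} {a : ℕ} (h : a ∈ l) :
    Nat.size a + 1 ≤ inputLength l :=
  List.single_le_sum (fun _ _ => Nat.zero_le _) _ (List.mem_map_of_mem h)

theorem length_le_inputLength (l : List ℕ) : l.length ≤ inputLength l := by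
  simp [inputLength]

theorem getD_lt_two_pow_inputLength (l : List ℕ) (i : ℕ) : l.getD i 0 < 2 ^ inputLength l := by
  by_cases h : i < l.length
  · rw [List.getD_eq_getElem _ _ h]
    exact (Nat.lt_size_self _).trans_le (Nat.pow_le_pow_right two_pos
      ((Nat.le_succ _).trans (size_succ_le_inputLength (List.getElem_mem h))))
  · rw [List.getD_eq_default _ _ (by omega)]
    positivity

namespace ShapInput

variable (I : ShapInput)

theorem length_encode : I.encode.length = 2 + 2 * I.m + I.m * I.m + 3 * I.n + I.n + 1 := by
  simp [encode, List.length_flatMap, encodeRat, GateLabel.length_encode]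
  ring

theorem n_le_inputLength : I.n + 1 ≤ inputLength I.encode := by
  have := length_le_inputLength I.encode
  rw [length_encode] at this
  omega

theorem m_le_inputLength : I.m ≤ inputLength I.encode := by
  have := length_le_inputLength I.encode
  rw [length_encode] at this
  omega

theorem ramInput_lt (k i : ℕ) : ramInput I.encode k i < 2 ^ inputLength I.encode := by
  rw [ramInput]
  split_ifs
  · cases i with
    | zero =>
      exact (length_le_inputLength I.encode).trans_lt Nat.lt_two_pow_self
    | succ i => exact getD_lt_two_pow_inputLength _ i
  · positivity

theorem den_le (y : Fin I.n) : (I.p y).den ≤ 2 ^ inputLength I.encode := by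
  have h := I.tape_marginal y (j := 2) (by norm_num)
  have h2 : (encodeRat (I.p y)).getD 2 0 = (I.p y).den := rfl
  rw [← h2, ← h]
  exact (I.ramInput_lt 0 _).le

theorem commonDen_le : commonDen I.p ≤ 2 ^ (inputLength I.encode * inputLength I.encode) := by
  have hn := I.n_le_inputLength
  calc commonDen I.p ≤ ∏ _y : Fin I.n, 2 ^ inputLength I.encode :=
        Finset.prod_le_prod' fun y _ => I.den_le y
    _ = 2 ^ (inputLength I.encode * I.n) := by simp [pow_mul]
    _ ≤ _ := Nat.pow_le_pow_right two_pos (Nat.mul_le_mul_left _ (by omega))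

theorem base_le : I.base ≤ 2 ^ (2 * inputLength I.encode ^ 2) := by
  have hn := I.n_le_inputLength
  have h : I.base ≤ 2 ^ I.n * 2 ^ (inputLength I.encode * inputLength I.encode) :=
    Nat.mul_le_mul_left _ I.commonDen_le
  rw [← pow_add] at h
  refine h.trans (Nat.pow_le_pow_right two_pos ?_)
  nlinarith

theorem base_pow_le : I.base ^ I.n ≤ 2 ^ (2 * inputLength I.encode ^ 3) := by
  have hn := I.n_le_inputLength
  refine (Nat.pow_le_pow_left I.base_le _).trans ?_
  rw [← pow_mul]
  refine Nat.pow_le_pow_right two_pos ?_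
  calc _ ≤ 2 * inputLength I.encode ^ 2 * inputLength I.encode :=
        Nat.mul_le_mul_left _ (by omega)
    _ = _ := by ring

theorem factorial_le : I.n.factorial ≤ 2 ^ (inputLength I.encode ^ 2) := by
  have hn := I.n_le_inputLength
  calc I.n.factorial ≤ I.n ^ I.n := Nat.factorial_le_pow _
    _ ≤ (2 ^ inputLength I.encode) ^ I.n := Nat.pow_le_pow_left
        ((show I.n ≤ inputLength I.encode by omega).trans Nat.lt_two_pow_self.le) _
    _ = 2 ^ (inputLength I.encode * I.n) := by rw [pow_mul]
    _ ≤ _ := Nat.pow_le_pow_right two_pos (by nlinarith)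

/-- With `N` the input length, the marker of `x` has about `2 * N ^ 3` digits and dominates; there
are fewer than `N` factors. -/
theorem totalWeight_le (hp : ∀ y, 0 ≤ I.p y ∧ I.p y ≤ 1) :
    totalWeight I.wt ≤ 2 ^ (4 * inputLength I.encode ^ 4) := by
  have hn := I.n_le_inputLength
  have hd := I.den_le
  have hb := I.base_pow_le
  generalize inputLength I.encode = N at *
  have h1 : ∀ y, (I.p y).den * (1 + I.marker y) ≤ 2 ^ (4 * N ^ 3) := by
    intro y
    have hm : I.marker y ≤ 2 ^ (2 * N ^ 3) := by
      refine le_trans ?_ hb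
      rw [marker]
      split_ifs
      · exact le_rfl
      · exact Nat.le_self_pow I.n_pos.ne' _
    have hm' : 1 + I.marker y ≤ 2 ^ (2 * N ^ 3 + 1) := by
      have := Nat.one_le_two_pow (n := 2 * N ^ 3)
      rw [pow_succ]; omega
    calc _ ≤ 2 ^ N * 2 ^ (2 * N ^ 3 + 1) := Nat.mul_le_mul (hd y) hm'
      _ = 2 ^ (N + (2 * N ^ 3 + 1)) := (pow_add _ _ _).symm
      _ ≤ _ := Nat.pow_le_pow_right two_pos (by
        have h3 : N ≤ N ^ 3 := Nat.le_self_pow (by norm_num) N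
        omega)
  rw [I.totalWeight_wt hp]
  calc _ ≤ ∏ _y : Fin I.n, 2 ^ (4 * N ^ 3) := Finset.prod_le_prod' fun y _ => h1 y
    _ = 2 ^ (4 * N ^ 3 * I.n) := by simp [pow_mul]
    _ ≤ 2 ^ (4 * N ^ 3 * N) := Nat.pow_le_pow_right two_pos (Nat.mul_le_mul_left _ (by omega))
    _ = _ := by ring_nf

theorem score_bound :
    (2 * (I.n * (I.n.factorial * I.n.factorial * I.base)) + I.scoreDen) * I.scoreDen ≤
      2 ^ (9 * inputLength I.encode ^ 2) := by
  have hn := I.n_le_inputLength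
  have hd := I.commonDen_le
  have hf := I.factorial_le
  have hb := I.base_le
  generalize inputLength I.encode = N at *
  have hN1 : N ≤ N ^ 2 := Nat.le_self_pow (by norm_num) N
  have hD : I.scoreDen ≤ 2 ^ (2 * N ^ 2) := by
    have h := Nat.mul_le_mul hd hf
    rw [← pow_add] at h
    exact h.trans (Nat.pow_le_pow_right two_pos (by nlinarith))
  have hF : I.n.factorial * I.n.factorial * I.base ≤ 2 ^ (4 * N ^ 2) := by
    have h := Nat.mul_le_mul (Nat.mul_le_mul hf hf) hb
    rw [← pow_add, ← pow_add] at h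
    exact h.trans (Nat.pow_le_pow_right two_pos (by omega))
  -- The strict inequality `n < N` pays for the factor `2`.
  have h2n : 2 * I.n ≤ 2 ^ N := by
    have h1 : I.n + 1 ≤ 2 ^ I.n := Nat.lt_two_pow_self
    have h2 : 2 ^ (I.n + 1) ≤ 2 ^ N := Nat.pow_le_pow_right two_pos hn
    rw [pow_succ] at h2
    omega
  have hS : 2 * (I.n * (I.n.factorial * I.n.factorial * I.base)) ≤ 2 ^ (5 * N ^ 2) := by
    rw [← mul_assoc]
    refine (Nat.mul_le_mul h2n hF).trans ?_
    rw [← pow_add]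
    exact Nat.pow_le_pow_right two_pos (by omega)
  have hD' : 2 ^ (2 * N ^ 2) ≤ 2 ^ (5 * N ^ 2) := Nat.pow_le_pow_right two_pos (by omega)
  have hsum : 2 * (I.n * (I.n.factorial * I.n.factorial * I.base)) + I.scoreDen ≤
      2 ^ (5 * N ^ 2 + 1) := by rw [pow_succ]; omega
  refine (Nat.mul_le_mul hsum hD).trans ?_
  rw [← pow_add]
  exact Nat.pow_le_pow_right two_pos (by omega)

/-- The largest exponents to cover are `4 * N ^ 4` for the total weight and `9 * N ^ 2` for the
fraction; as `N ≥ 1`, the value `10 * N ^ 4` strictly exceeds both. -/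
theorem fits (hp : ∀ y, 0 ≤ I.p y ∧ I.p y ≤ 1) : I.Fits (10 * inputLength I.encode ^ 4) := by
  have hn := I.n_le_inputLength
  have hm := I.m_le_inputLength
  have h1 : 1 ≤ inputLength I.encode := by omega
  have hpow : ∀ k ≤ 4, inputLength I.encode ^ k ≤ inputLength I.encode ^ 4 :=
    fun k hk => Nat.pow_le_pow_right h1 hk
  have p0 := hpow 0 (by norm_num)
  have p1 := hpow 1 (by norm_num)
  have p2 := hpow 2 (by norm_num)
  have p3 := hpow 3 (by norm_num)
  rw [pow_zero] at p0
  rw [pow_one] at p1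
  have lt : ∀ {a k : ℕ}, a ≤ 2 ^ k → k < 10 * inputLength I.encode ^ 4 →
      a < 2 ^ (10 * inputLength I.encode ^ 4) := fun ha hk =>
    ha.trans_lt (Nat.pow_lt_pow_right one_lt_two hk)
  exact ⟨by omega, by omega, by omega, lt I.base_pow_le (by omega),
    lt (I.totalWeight_le hp) (by omega), lt I.factorial_le (by omega), lt I.score_bound (by omega)⟩

end ShapInput

/-! ### The whole program and its running time -/

namespace ShapProgram

open RamExpr RamProg Runs

variable {I : ShapInput} {L : ℕ} {σ : RamMemory}

/-- The program that computes the SHAP-score. -/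
def program : RamProg :=
  seq scales <| seq topPower <| seq markers <| seq evalGates <| seq selectOutput <|
    seq factorials <| seq sumDigits <| seq reduceFraction writeScore

theorem runs_program (hI : I ∈ shapInstances) (hL : I.Fits L) (hL2 : 2 ≤ L) :
    Runs L program (ramInput I.encode) fun τ => RamOutput τ (encodeRat I.score) := by
  have hp := hI.2.2
  refine seq ((runs_scales hL rfl).frame.mono ?_)
  rintro τ1 ⟨f1, -, a2, a3⟩
  have a0 : τ1 0 = I.tape := f1 0 (by decide)
  -- Array `7` is still blank when the gates are evaluated, so its initial counts are at most the
  -- total weight.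
  have a7 : ∀ h, τ1 7 h = 0 := fun h => by rw [f1 7 (by decide)]; rfl
  clear f1
  refine seq ((runs_topPower hL a0 a3).frame.mono ?_)
  rintro τ2 ⟨f, -, b4⟩
  rw [← f 0 (by decide)] at a0
  rw [← f 2 (by decide)] at a2
  rw [← f 3 (by decide)] at a3
  rw [← f 7 (by decide)] at a7
  clear f
  refine seq ((runs_markers hp hL a0 a3 b4).frame.mono ?_)
  rintro τ3 ⟨f, -, c5, c6⟩
  rw [← f 0 (by decide)] at a0
  rw [← f 2 (by decide)] at a2
  rw [← f 3 (by decide)] at a3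
  rw [← f 4 (by decide)] at b4
  rw [← f 7 (by decide)] at a7
  clear f
  refine seq ((runs_evalGates hI hL a0 c5 c6 fun h => a7 h).frame.mono ?_)
  rintro τ4 ⟨f, -, d7⟩
  rw [← f 0 (by decide)] at a0
  rw [← f 2 (by decide)] at a2
  rw [← f 3 (by decide)] at a3
  rw [← f 4 (by decide)] at b4
  clear f
  refine seq ((runs_selectOutput hL a0 d7).frame.mono ?_)
  rintro τ5 ⟨f, -, e15⟩
  rw [← f 0 (by decide)] at a0
  rw [← f 2 (by decide)] at a2
  rw [← f 3 (by decide)] at a3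
  rw [← f 4 (by decide)] at b4
  clear f
  refine seq ((runs_factorials hL a0).frame.mono ?_)
  rintro τ6 ⟨f, -, g8⟩
  rw [← f 0 (by decide)] at a0
  rw [← f 2 (by decide)] at a2
  rw [← f 3 (by decide)] at a3
  rw [← f 4 (by decide)] at b4
  rw [← f 15 (by decide)] at e15
  clear f
  refine seq ((runs_sumDigits hp hL a0 a3 b4 g8 e15).frame.mono ?_)
  rintro τ7 ⟨f, -, h17, h18⟩
  rw [← f 0 (by decide)] at a0
  rw [← f 2 (by decide)] at a2
  rw [← f 8 (by decide)] at g8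
  clear f
  refine seq ((runs_reduceFraction hp hL a0 a2 (g8 _ le_rfl) h17 h18).frame.mono ?_)
  rintro τ8 ⟨f, -, k21, k22, k19⟩
  rw [← f 17 (by decide)] at h17
  rw [← f 18 (by decide)] at h18
  rw [I.score_eq_div hp]
  exact runs_writeScore hL2 I.scoreDen_pos h17 h18 k21 k22 k19

end ShapProgram

/-- SHAP-scores of deterministic and decomposable Boolean circuits under product distributions
with rational marginals can be computed in polynomial time. -/
theorem mainTheorem2 :
    PolyTimeComputableOn ShapInput.encode encodeRat shapInstances ShapInput.score := by
  refine ⟨ShapProgram.program,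
    -- The time bound `timeBound.eval L * L` at `L = 10 * N ^ 4`, as a polynomial in the input
    -- length `N`.
    (ShapProgram.program.timeBound * Polynomial.X).comp (10 * Polynomial.X ^ 4), fun I hI => ?_⟩
  have hL := I.fits hI.2.2
  have hn := I.n_le_inputLength
  have h4 : inputLength I.encode ≤ inputLength I.encode ^ 4 := Nat.le_self_pow (by norm_num) _
  obtain ⟨τ, t, h1, h2, -, h3⟩ := ShapProgram.runs_program hI hL (by omega) fun k i =>
    (I.ramInput_lt k i).trans_le (Nat.pow_le_pow_right two_pos (by omega))
  exact ⟨τ, t, h1, by simpa using h2, h3⟩
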